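/- Let $(X,d,\mu)$ be a proper metric measure space, i.e. a metric space whose closed balls are compact, with a Borel measure that is finite on compact sets (for example a complete connected Riemannian manifold with its distance and volume). For $A\subseteq X$ and $R\ge 0$ write $B_R(A)=\{x\in X: d(x,A)\le R\}$, where $d(x,\emptyset)=\infty$. Let $W\subseteq X$ be a half-space: a closed subset such that $\partial W$ has measure zero and the function $x\mapsto d(x,X\setminus W)$ is unbounded. A subset $W_+\subseteq W$ is *admissible* if, with $W_-:=\overline{W\setminus W_+}$ and $N:=W_+\cap W_-$ (closures and interiors taken in $W$), it is regular closed, $W_+=\overline{W_+^\circ}$, and (i) for each $R\ge0$ there is $S\ge0$ with $B_R(W_+)\cap B_R(W_-)\subseteq B_S(N)$; (ii) $B_R(X\setminus W)\cap B_R(N)$ is bounded for each $R\ge0$; (iii) $N$ has measure zero. Two admissible subsets $W_+,W_+'$ of $W$ are *bordant* if $W_+\cap W_+'$ is admissible and $B_R(X\setminus W)\cap(W_+\,\Delta\,W_+')$ is bounded for each $R\ge 0$. Let $C^*_W(\partial W)\subseteq\mathcal B(L^2(W))$ be the Roe algebra of $W$ localised at $\partial W$: the norm closure of the algebra of operators $A$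 that are locally compact ($Af$ and $fA$ are compact for all $f\in C_c(W)$), have finite propagation (there is $R\ge0$ with $fAg=0$ whenever $f,g\in C_0(W)$ have supports at least $R$ apart) and are supported near $\partial W$ (there is $R\ge0$ with $Aw=0$ for all $w\in C_c(W)$ whose support has distance at least $R$ from $\partial W$). Denote by $C^*_W(\partial W)^+$ its unitization. For an admissible subset $W_+$ and a unitary $u\in M_n(C^*_W(\partial W)^+)$ let $T_u=\Pi_{W_+}u\,\Pi_{W_+}^*\in\mathcal B(L^2(W_+)^n)$, where $\Pi_{W_+}:L^2(W)\to L^2(W_+)$ is the restriction map, acting diagonally. The index map of $W_+$ is the homomorphism $$\theta_{W_+}:K_1(C^*_W(\partial W))\to\mathbb Z,\qquad [u]\mapsto \operatorname{Index} T_u .$$ **Proposition.** If $W_+$ and $W_+'$ are bordant admissible subsets of $W$, then the index maps $\theta_{W_+}$ and $\theta_{W_+'}$ are well defined (every $T_u$ is Fredholm, and there is exactly one homomorphism with $\theta[u]=\operatorname{Index}T_u$ for all unitaries $u$), and $\theta_{W_+}=\theta_{W_+'}$. -/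

import Mathlib

open MeasureTheory Metric Set
open scoped CompactlySupported ZeroAtInfty BoundedContinuousFunction ENNReal

noncomputable section

namespace CoarseIndex

/-! ### The group `K₁` of a C*-algebra -/

/-- The unitary group `U_n(A⁺)` of the matrix algebra `M_n(A⁺)`, where `A⁺ = A ⊕ ℂ` is the
unitization of the C*-algebra `A`. -/
abbrev UnitaryMatrix (A : Type*) [NonUnitalCStarAlgebra A] (n : ℕ) : Type _ :=
  unitary (Matrix (Fin n) (Fin n) (Unitization ℂ A))

/-- The identification of the disjoint union of `n` and `m - n` points with `m` points. -/
def finSumEquiv {n m : ℕ} (h : n ≤ m) : Fin n ⊕ Fin (m - n) ≃ Fin m :=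
  finSumFinEquiv.trans (finCongr (Nat.add_sub_of_le h))

/-- The block matrix `u ⊕ 1` of size `m`. -/
def padMatrix {R : Type*} [Zero R] [One R] {n m : ℕ} (h : n ≤ m) (u : Matrix (Fin n) (Fin n) R) :
    Matrix (Fin m) (Fin m) R :=
  Matrix.reindex (finSumEquiv h) (finSumEquiv h) (Matrix.fromBlocks u 0 0 1)

theorem padMatrix_apply {R : Type*} [Zero R] [One R] {n m : ℕ} (h : n ≤ m)
    (u : Matrix (Fin n) (Fin n) R) (i j : Fin m) :
    padMatrix h u i j = if hij : (i : ℕ) < n ∧ (j : ℕ) < n then u ⟨i, hij.1⟩ ⟨j, hij.2⟩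
      else if i = j then 1 else 0 := by
  obtain ⟨i, rfl⟩ := (finSumEquiv h).surjective i
  obtain ⟨j, rfl⟩ := (finSumEquiv h).surjective j
  rcases i with i | i <;> rcases j with j | j <;>
    simp [padMatrix, finSumEquiv, Matrix.one_apply, Fin.ext_iff] <;> omega

theorem padMatrix_mul {R : Type*} [Semiring R] {n m : ℕ} (h : n ≤ m)
    (u v : Matrix (Fin n) (Fin n) R) :
    padMatrix h (u * v) = padMatrix h u * padMatrix h v := by
  simp [padMatrix, Matrix.submatrix_mul_equiv, Matrix.fromBlocks_multiply]

theorem padMatrix_one {R : Type*} [Zero R] [One R] {n m : ℕ} (h : n ≤ m) :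
    padMatrix h (1 : Matrix (Fin n) (Fin n) R) = 1 := by
  simp [padMatrix]

theorem padMatrix_star {R : Type*} [Semiring R] [StarRing R] {n m : ℕ} (h : n ≤ m)
    (u : Matrix (Fin n) (Fin n) R) : padMatrix h (star u) = star (padMatrix h u) := by
  simp [padMatrix, Matrix.star_eq_conjTranspose, Matrix.fromBlocks_conjTranspose]

theorem padMatrix_padMatrix {R : Type*} [Zero R] [One R] {n m k : ℕ} (h : n ≤ m) (h' : m ≤ k)
    (u : Matrix (Fin n) (Fin n) R) :
    padMatrix h' (padMatrix h u) = padMatrix (h.trans h') u := by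
  ext i j
  simp only [padMatrix_apply, Fin.ext_iff]
  split_ifs <;> first | rfl | omega

theorem padMatrix_self {R : Type*} [Zero R] [One R] {n : ℕ} (h : n ≤ n)
    (u : Matrix (Fin n) (Fin n) R) : padMatrix h u = u := by
  ext i j
  simp [padMatrix_apply]

/-- The stabilisation homomorphism `U_n(A⁺) → U_m(A⁺)`, `u ↦ u ⊕ 1`. -/
def pad (A : Type*) [NonUnitalCStarAlgebra A] (n m : ℕ) (h : n ≤ m) :
    UnitaryMatrix A n →* UnitaryMatrix A m where
  toFun u := ⟨padMatrix h u.1, by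
    rw [Unitary.mem_iff, ← padMatrix_star, ← padMatrix_mul, ← padMatrix_mul]
    simp [padMatrix_one]⟩
  map_one' := Subtype.ext (padMatrix_one h)
  map_mul' u v := Subtype.ext (padMatrix_mul h u.1 v.1)

instance pad_directedSystem (A : Type*) [NonUnitalCStarAlgebra A] :
    DirectedSystem (UnitaryMatrix A) (fun n m h => pad A n m h) where
  map_self _ u := Subtype.ext (padMatrix_self _ u.1)
  map_map _ _ _ _ _ u := Subtype.ext (padMatrix_padMatrix _ _ u.1)

theorem continuous_pad (A : Type*) [NonUnitalCStarAlgebra A] (n m : ℕ) (h : n ≤ m) :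
    Continuous (pad A n m h) := by
  refine Continuous.subtype_mk ?_ _
  refine continuous_matrix fun i j => ?_
  simp only [padMatrix_apply]
  split_ifs
  · exact (continuous_apply_apply _ _).comp continuous_subtype_val
  · exact continuous_const
  · exact continuous_const

/-- The direct limit `U_∞(A⁺)` of the groups `U_n(A⁺)` along `u ↦ u ⊕ 1`. -/
abbrev UnitaryInf (A : Type*) [NonUnitalCStarAlgebra A] : Type _ :=
  DirectLimit (UnitaryMatrix A) (pad A)

/-- The image of `u ∈ U_n(A⁺)` in `U_∞(A⁺)`. -/
def toInf {A : Type*} [NonUnitalCStarAlgebra A] {n : ℕ} (u : UnitaryMatrix A n) : UnitaryInf A :=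
  ⟦⟨n, u⟩⟧

theorem toInf_pad {A : Type*} [NonUnitalCStarAlgebra A] {n m : ℕ} (h : n ≤ m)
    (u : UnitaryMatrix A n) : toInf (pad A n m h u) = toInf u :=
  DirectLimit.mk_apply n m u h

theorem toInf_mul {A : Type*} [NonUnitalCStarAlgebra A] {n : ℕ} (u v : UnitaryMatrix A n) :
    toInf (u * v) = toInf u * toInf v :=
  (DirectLimit.mul_def n u v).symm

theorem joined_pad {A : Type*} [NonUnitalCStarAlgebra A] {n m : ℕ} (h : n ≤ m)
    {u : UnitaryMatrix A n} (hu : Joined u 1) : Joined (pad A n m h u) 1 := by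
  have := hu.map (continuous_pad A n m h)
  rwa [map_one] at this

/-- The elements of `U_∞(A⁺)` represented by a unitary matrix that is connected to `1` by a
norm-continuous path of unitary matrices. -/
def identityComponent (A : Type*) [NonUnitalCStarAlgebra A] : Subgroup (UnitaryInf A) where
  carrier := {x | ∃ (n : ℕ) (u : UnitaryMatrix A n), toInf u = x ∧ Joined u 1}
  one_mem' := ⟨0, 1, (DirectLimit.one_def 0).symm, Joined.refl _⟩
  mul_mem' := by
    rintro _ _ ⟨n, u, rfl, hu⟩ ⟨m, v, rfl, hv⟩
    refine ⟨max n m, pad A n _ (le_max_left n m) u * pad A m _ (le_max_right n m) v, ?_, ?_⟩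
    · rw [toInf_mul, toInf_pad, toInf_pad]
    · simpa using (joined_pad (le_max_left n m) hu).mul (joined_pad (le_max_right n m) hv)
  inv_mem' := by
    rintro _ ⟨n, u, rfl, hu⟩
    exact ⟨n, u⁻¹, rfl, by simpa using hu.inv⟩

instance identityComponent_normal (A : Type*) [NonUnitalCStarAlgebra A] :
    (identityComponent A).Normal where
  conj_mem := by
    rintro _ ⟨n, u, rfl, hu⟩ g
    obtain ⟨m, w, rfl⟩ : ∃ (m : ℕ) (w : UnitaryMatrix A m), toInf w = g := by
      obtain ⟨m, w, rfl⟩ := DirectLimit.exists_eq_mk (pad A) g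
      exact ⟨m, w, rfl⟩
    refine ⟨max n m, pad A m _ (le_max_right n m) w * pad A n _ (le_max_left n m) u *
      (pad A m _ (le_max_right n m) w)⁻¹, ?_, ?_⟩
    · rw [toInf_mul, toInf_mul, toInf_pad, toInf_pad]
      congr 1
      exact congrArg (·⁻¹) (toInf_pad (le_max_right n m) w)
    · simpa using ((Joined.refl (pad A m _ (le_max_right n m) w)).mul
        (joined_pad (le_max_left n m) hu)).mul (Joined.refl (pad A m _ (le_max_right n m) w)⁻¹)

/-- The group `K₁(A)`: homotopy classes of unitary matrices over `A⁺`, where `u` is identified with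
`u ⊕ 1`. The group operation, written additively, is induced by the product of unitaries (and hence
equals the one induced by the direct sum). -/
abbrev K1 (A : Type*) [NonUnitalCStarAlgebra A] : Type _ :=
  Additive (UnitaryInf A ⧸ identityComponent A)

/-- The class `[u] ∈ K₁(A)` of a unitary `u ∈ M_n(A⁺)`. -/
def K1.mk {A : Type*} [NonUnitalCStarAlgebra A] {n : ℕ} (u : UnitaryMatrix A n) : K1 A :=
  Additive.ofMul (QuotientGroup.mk (toInf u))

/-! ### Operators on `L²` of a proper metric measure space -/

/-- The Hilbert space `L²(Y, ν)` of complex-valued functions. -/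
abbrev L2 {Y : Type*} [MeasurableSpace Y] (ν : Measure Y) : Type _ := Lp ℂ 2 ν

theorem memLp_bounded_mul {Y : Type*} [TopologicalSpace Y] [MeasurableSpace Y]
    [OpensMeasurableSpace Y] {ν : Measure Y} (f : Y →ᵇ ℂ) (v : L2 ν) :
    MemLp (fun y => f y * v y) 2 ν :=
  (Lp.memLp v).of_le_mul (c := ‖f‖)
    (f.continuous.aestronglyMeasurable.mul (Lp.aestronglyMeasurable v))
    (.of_forall fun y => by
      rw [norm_mul]
      exact mul_le_mul_of_nonneg_right (f.norm_coe_le_norm y) (norm_nonneg _))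

/-- The multiplication operator on `L²(Y)` by a bounded continuous function. -/
def mulOp {Y : Type*} [TopologicalSpace Y] [MeasurableSpace Y] [OpensMeasurableSpace Y]
    (ν : Measure Y) (f : Y →ᵇ ℂ) : L2 ν →L[ℂ] L2 ν :=
  LinearMap.mkContinuous
    { toFun := fun v => (memLp_bounded_mul f v).toLp
      map_add' := fun v w => by
        rw [← MemLp.toLp_add]
        refine MemLp.toLp_congr _ _ ?_
        filter_upwards [Lp.coeFn_add v w] with y hy
        rw [hy]
        exact mul_add _ _ _
      map_smul' := fun c v => by
        rw [RingHom.id_apply, ← MemLp.toLp_const_smul]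
        refine MemLp.toLp_congr _ _ ?_
        filter_upwards [Lp.coeFn_smul c v] with y hy
        simp [hy]; ring }
    ‖f‖ (fun v => by
      refine Lp.norm_le_mul_norm_of_ae_le_mul ?_
      filter_upwards [(memLp_bounded_mul f v).coeFn_toLp] with y hy
      simp only [LinearMap.coe_mk, AddHom.coe_mk, hy, norm_mul]
      exact mul_le_mul_of_nonneg_right (f.norm_coe_le_norm y) (norm_nonneg _))

theorem mulOp_coe {Y : Type*} [TopologicalSpace Y] [MeasurableSpace Y] [OpensMeasurableSpace Y]
    {ν : Measure Y} (f : Y →ᵇ ℂ) (v : L2 ν) : mulOp ν f v =ᵐ[ν] fun y => f y * v y :=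
  (memLp_bounded_mul f v).coeFn_toLp

theorem mulOp_mul {Y : Type*} [TopologicalSpace Y] [MeasurableSpace Y] [OpensMeasurableSpace Y]
    {ν : Measure Y} (f g : Y →ᵇ ℂ) : mulOp ν (f * g) = mulOp ν f * mulOp ν g := by
  ext1 v
  refine Lp.ext ?_
  filter_upwards [mulOp_coe (f * g) v, mulOp_coe f (mulOp ν g v), mulOp_coe g v] with y h1 h2 h3
  simp [h1, h2, h3, mul_assoc]

theorem mulOp_add {Y : Type*} [TopologicalSpace Y] [MeasurableSpace Y] [OpensMeasurableSpace Y]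
    {ν : Measure Y} (f g : Y →ᵇ ℂ) : mulOp ν (f + g) = mulOp ν f + mulOp ν g := by
  ext1 v
  refine Lp.ext ?_
  filter_upwards [mulOp_coe (f + g) v, mulOp_coe f v, mulOp_coe g v,
    Lp.coeFn_add (mulOp ν f v) (mulOp ν g v)] with y h1 h2 h3 h4
  rw [add_apply, h4, Pi.add_apply, h1, h2, h3]
  exact add_mul _ _ _

theorem mulOp_one {Y : Type*} [TopologicalSpace Y] [MeasurableSpace Y] [OpensMeasurableSpace Y]
    {ν : Measure Y} : mulOp ν (1 : Y →ᵇ ℂ) = 1 := by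
  ext1 v
  refine Lp.ext ?_
  filter_upwards [mulOp_coe (1 : Y →ᵇ ℂ) v] with y h1
  simp [h1]

theorem mulOp_star {Y : Type*} [TopologicalSpace Y] [MeasurableSpace Y] [OpensMeasurableSpace Y]
    {ν : Measure Y} (f : Y →ᵇ ℂ) : mulOp ν (star f) = star (mulOp ν f) := by
  rw [ContinuousLinearMap.star_eq_adjoint, ContinuousLinearMap.eq_adjoint_iff]
  intro v w
  rw [L2.inner_def, L2.inner_def]
  refine integral_congr_ae ?_
  filter_upwards [mulOp_coe (star f) v, mulOp_coe f w] with y h1 h2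
  simp [h1, h2]; ring

/-- A compactly supported continuous function as a bounded function. -/
def ccBCF {Y : Type*} [TopologicalSpace Y] (f : C_c(Y, ℂ)) : Y →ᵇ ℂ :=
  (⟨f.toContinuousMap, f.hasCompactSupport.is_zero_at_infty⟩ : C₀(Y, ℂ)).toBCF

/-- A compactly supported continuous function as an element of `L²(Y)`. -/
def ccL2 {Y : Type*} [TopologicalSpace Y] [MeasurableSpace Y] [OpensMeasurableSpace Y]
    (ν : Measure Y) [IsFiniteMeasureOnCompacts ν] (w : C_c(Y, ℂ)) : L2 ν :=
  (w.continuous.memLp_of_hasCompactSupport w.hasCompactSupport).toLp w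

theorem dense_ccL2 {Y : Type*} [MetricSpace Y] [ProperSpace Y] [MeasurableSpace Y] [BorelSpace Y]
    (ν : Measure Y) [IsFiniteMeasureOnCompacts ν] : DenseRange (ccL2 ν) := by
  intro v
  rw [Metric.mem_closure_iff]
  intro ε hε
  obtain ⟨g, hg, hle, hc, hm⟩ := (Lp.memLp v).exists_hasCompactSupport_eLpNorm_sub_le
    (by norm_num) (ε := ENNReal.ofReal (ε / 2)) (by simpa using hε)
  refine ⟨_, ⟨⟨⟨g, hc⟩, hg⟩, rfl⟩, ?_⟩
  have : dist v (ccL2 ν ⟨⟨g, hc⟩, hg⟩) ≤ ε / 2 := by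
    rw [Lp.dist_def]
    refine ENNReal.toReal_le_of_le_ofReal (by positivity) (le_trans (le_of_eq ?_) hle)
    refine eLpNorm_congr_ae ?_
    have h : ccL2 ν ⟨⟨g, hc⟩, hg⟩ =ᵐ[ν] g := MemLp.coeFn_toLp _
    filter_upwards [h] with y hy
    simp [hy]
  linarith


/-- `A` is locally compact: `A f` and `f A` are compact operators for all `f ∈ C_c(Y)`. -/
def IsLocallyCompact {Y : Type*} [TopologicalSpace Y] [MeasurableSpace Y] [OpensMeasurableSpace Y]
    {ν : Measure Y} (A : L2 ν →L[ℂ] L2 ν) : Prop :=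
  ∀ f : C_c(Y, ℂ), IsCompactOperator (A * mulOp ν (ccBCF f)) ∧
    IsCompactOperator (mulOp ν (ccBCF f) * A)

/-- `A` has finite propagation: for some `R ≥ 0`, `f A g = 0` whenever `f, g ∈ C₀(Y)` have supports
at least `R` apart. -/
def HasFinitePropagation {Y : Type*} [MetricSpace Y] [MeasurableSpace Y] [OpensMeasurableSpace Y]
    {ν : Measure Y} (A : L2 ν →L[ℂ] L2 ν) : Prop :=
  ∃ R : ℝ, 0 ≤ R ∧ ∀ f g : C₀(Y, ℂ), (∀ x ∈ tsupport f, ∀ y ∈ tsupport g, R ≤ dist x y) →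
    mulOp ν f.toBCF * A * mulOp ν g.toBCF = 0

/-- `A` is supported near `Z`: for some `R ≥ 0`, `A w = 0` for all `w ∈ C_c(Y)` the support of
which has distance at least `R` from `Z`. -/
def IsSupportedNear {Y : Type*} [MetricSpace Y] [MeasurableSpace Y] [OpensMeasurableSpace Y]
    {ν : Measure Y} [IsFiniteMeasureOnCompacts ν] (Z : Set Y) (A : L2 ν →L[ℂ] L2 ν) : Prop :=
  ∃ R : ℝ, 0 ≤ R ∧ ∀ w : C_c(Y, ℂ), (∀ x ∈ tsupport w, ∀ z ∈ Z, R ≤ dist x z) →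
    A (ccL2 ν w) = 0

theorem exists_cc_one {Y : Type*} [MetricSpace Y] [ProperSpace Y] [MeasurableSpace Y] [BorelSpace Y]
    (ν : Measure Y) [IsFiniteMeasureOnCompacts ν] (w : C_c(Y, ℂ)) :
    ∃ c : C_c(Y, ℂ), ∀ y ∈ tsupport w, c y = 1 := by
  obtain ⟨f, h1, -, h3, -⟩ := exists_continuous_one_zero_of_isCompact
    (s := tsupport w) (t := ∅) w.hasCompactSupport isClosed_empty (by simp)
  refine ⟨⟨⟨fun y => (f y : ℂ), by fun_prop⟩, ?_⟩, ?_⟩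
  · exact h3.comp_left (g := fun r : ℝ => (r : ℂ)) (by simp)
  · intro y hy
    simpa using h1 hy

theorem mulOp_ccL2 {Y : Type*} [MetricSpace Y] [ProperSpace Y] [MeasurableSpace Y] [BorelSpace Y]
    {ν : Measure Y} [IsFiniteMeasureOnCompacts ν] (f : Y →ᵇ ℂ) (v w : C_c(Y, ℂ))
    (h : ∀ y, f y * v y = w y) : mulOp ν f (ccL2 ν v) = ccL2 ν w := by
  refine Lp.ext ?_
  have h1 : ccL2 ν v =ᵐ[ν] v := MemLp.coeFn_toLp _
  have h2 : ccL2 ν w =ᵐ[ν] w := MemLp.coeFn_toLp _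
  filter_upwards [h1, h2, mulOp_coe f (ccL2 ν v)] with y h1 h2 h3
  rw [h3, h1, h2, h]

theorem exists_ccL2_eq {Y : Type*} [MetricSpace Y] [ProperSpace Y] [MeasurableSpace Y]
    [BorelSpace Y] (ν : Measure Y) [IsFiniteMeasureOnCompacts ν] (w : C_c(Y, ℂ)) :
    ∃ c : C_c(Y, ℂ), mulOp ν (ccBCF c) (ccL2 ν w) = ccL2 ν w ∧
      mulOp ν (ccBCF w) (ccL2 ν c) = ccL2 ν w := by
  obtain ⟨c, hc⟩ := exists_cc_one ν w
  have key : ∀ y, c y * w y = w y := fun y => by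
    by_cases hy : y ∈ tsupport w
    · rw [hc y hy, one_mul]
    · rw [image_eq_zero_of_notMem_tsupport hy, mul_zero]
  exact ⟨c, mulOp_ccL2 _ _ _ key, mulOp_ccL2 _ _ _ fun y => by
    rw [mul_comm]; exact key y⟩

theorem clm_eq_zero {Y : Type*} [MetricSpace Y] [ProperSpace Y] [MeasurableSpace Y] [BorelSpace Y]
    {ν : Measure Y} [IsFiniteMeasureOnCompacts ν] {T : L2 ν →L[ℂ] L2 ν}
    (h : ∀ w, T (ccL2 ν w) = 0) : T = 0 :=
  DFunLike.coe_injective <| (dense_ccL2 ν).equalizer T.continuous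
    (0 : L2 ν →L[ℂ] L2 ν).continuous (funext h)

theorem eq_zero_of_mul_cc {Y : Type*} [MetricSpace Y] [ProperSpace Y] [MeasurableSpace Y]
    [BorelSpace Y] {ν : Measure Y} [IsFiniteMeasureOnCompacts ν] {T : L2 ν →L[ℂ] L2 ν}
    (h : ∀ c : C_c(Y, ℂ), T * mulOp ν (ccBCF c) = 0) : T = 0 := by
  refine clm_eq_zero fun w => ?_
  obtain ⟨c, hc, -⟩ := exists_ccL2_eq ν w
  rw [← hc]
  exact DFunLike.congr_fun (h c) _

theorem tsupport_star {Y : Type*} [TopologicalSpace Y] (f : Y →ᵇ ℂ) :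
    tsupport ⇑(star f) = tsupport f := by
  unfold tsupport
  congr 1
  ext y
  simp

theorem mulOp_ccBCF_star {Y : Type*} [TopologicalSpace Y] [MeasurableSpace Y]
    [OpensMeasurableSpace Y] {ν : Measure Y} (c : C_c(Y, ℂ)) :
    mulOp ν (ccBCF (star c)) = star (mulOp ν (ccBCF c)) := by
  rw [← mulOp_star]
  rfl

theorem eq_zero_of_cc_mul {Y : Type*} [MetricSpace Y] [ProperSpace Y] [MeasurableSpace Y]
    [BorelSpace Y] {ν : Measure Y} [IsFiniteMeasureOnCompacts ν] {T : L2 ν →L[ℂ] L2 ν}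
    (h : ∀ c : C_c(Y, ℂ), mulOp ν (ccBCF c) * T = 0) : T = 0 := by
  rw [← star_eq_zero]
  refine eq_zero_of_mul_cc fun c => ?_
  rw [← star_star c, mulOp_ccBCF_star, ← star_mul, h, star_zero]

/-- Finite propagation, tested on bounded continuous functions. -/
theorem HasFinitePropagation.bcf {Y : Type*} [MetricSpace Y] [ProperSpace Y] [MeasurableSpace Y]
    [BorelSpace Y] {ν : Measure Y} [IsFiniteMeasureOnCompacts ν] {A : L2 ν →L[ℂ] L2 ν} {R : ℝ}
    (hA : ∀ f g : C₀(Y, ℂ), (∀ x ∈ tsupport f, ∀ y ∈ tsupport g, R ≤ dist x y) →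
      mulOp ν f.toBCF * A * mulOp ν g.toBCF = 0)
    (f g : Y →ᵇ ℂ) (h : ∀ x ∈ tsupport f, ∀ y ∈ tsupport g, R ≤ dist x y) :
    mulOp ν f * A * mulOp ν g = 0 := by
  refine eq_zero_of_cc_mul fun c => eq_zero_of_mul_cc fun d => ?_
  let f' : C₀(Y, ℂ) := ⟨(ccBCF c * f).toContinuousMap,
    (c.hasCompactSupport.mul_right (f' := f)).is_zero_at_infty⟩
  let g' : C₀(Y, ℂ) := ⟨(g * ccBCF d).toContinuousMap,
    (d.hasCompactSupport.mul_left (f := g)).is_zero_at_infty⟩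
  have := hA f' g' (fun x hx y hy => h x (tsupport_mul_subset_right (f := c) (g := f) hx) y
    (tsupport_mul_subset_left (f := g) (g := d) hy))
  have e1 : f'.toBCF = ccBCF c * f := rfl
  have e2 : g'.toBCF = g * ccBCF d := rfl
  rw [e1, e2, mulOp_mul, mulOp_mul] at this
  simpa only [mul_assoc] using this

theorem IsSupportedNear.bcf {Y : Type*} [MetricSpace Y] [ProperSpace Y] [MeasurableSpace Y]
    [BorelSpace Y] {ν : Measure Y} [IsFiniteMeasureOnCompacts ν] {Z : Set Y}
    {A : L2 ν →L[ℂ] L2 ν} {R : ℝ}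
    (hA : ∀ w : C_c(Y, ℂ), (∀ x ∈ tsupport w, ∀ z ∈ Z, R ≤ dist x z) → A (ccL2 ν w) = 0)
    (g : Y →ᵇ ℂ) (h : ∀ x ∈ tsupport g, ∀ z ∈ Z, R ≤ dist x z) : A * mulOp ν g = 0 := by
  refine clm_eq_zero fun w => ?_
  let w' : C_c(Y, ℂ) := ⟨(g * ccBCF w).toContinuousMap,
    w.hasCompactSupport.mul_left (f := g)⟩
  have : mulOp ν g (ccL2 ν w) = ccL2 ν w' := mulOp_ccL2 _ _ _ fun _ => rfl
  change A (mulOp ν g (ccL2 ν w)) = 0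
  rw [this]
  exact hA w' fun x hx => h x (tsupport_mul_subset_left (f := g) (g := w) hx)

theorem exists_cutoff {Y : Type*} [MetricSpace Y] (S : Set Y) (r : ℝ) :
    ∃ k : Y →ᵇ ℂ, (∀ y ∈ tsupport k, ∃ s ∈ S, dist y s < r + 2) ∧
      ∀ y ∈ tsupport (1 - k : Y →ᵇ ℂ), ∀ s ∈ S, r ≤ dist y s := by
  let E := thickening r S
  let t := thickenedIndicator (zero_lt_one' ℝ) E
  have hb : ∀ y, ‖((t y : ℝ) : ℂ)‖ ≤ 1 := fun y => by
    refine (Complex.norm_real _).trans_le ?_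
    refine (Real.norm_of_nonneg (NNReal.coe_nonneg (t y))).trans_le ?_
    exact_mod_cast thickenedIndicator_le_one (zero_lt_one' ℝ) E y
  let k : Y →ᵇ ℂ := BoundedContinuousFunction.ofNormedAddCommGroup
    (fun y => ((t y : ℝ) : ℂ)) (by fun_prop) 1 hb
  have hk : ∀ y, k y = ((t y : ℝ) : ℂ) := fun _ => rfl
  refine ⟨k, fun y hy => ?_, fun y hy s hs => ?_⟩
  · have h1 : tsupport k ⊆ cthickening 1 E := by
      refine closure_minimal (fun x hx => ?_) isClosed_cthickening
      by_contra hx'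
      refine hx ?_
      rw [hk]
      have := thickenedIndicator_zero (zero_lt_one' ℝ) E
        (fun h => hx' (thickening_subset_cthickening _ _ h))
      simp [t, this]
    have h2 : y ∈ thickening (3 / 2) E :=
      cthickening_subset_thickening' (by norm_num) (by norm_num) E (h1 hy)
    obtain ⟨e, he, hye⟩ := mem_thickening_iff.1 h2
    obtain ⟨s, hs, hes⟩ := mem_thickening_iff.1 he
    exact ⟨s, hs, by linarith [dist_triangle y e s]⟩
  · have h1 : tsupport (1 - k : Y →ᵇ ℂ) ⊆ Eᶜ := by
      refine closure_minimal (fun x hx hxE => hx ?_) isOpen_thickening.isClosed_compl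
      have := thickenedIndicator_one (zero_lt_one' ℝ) E hxE
      simp [hk, t, this]
    by_contra! hlt
    exact h1 hy (mem_thickening_iff.2 ⟨s, hs, hlt⟩)

theorem mulOp_split {Y : Type*} [TopologicalSpace Y] [MeasurableSpace Y] [OpensMeasurableSpace Y]
    {ν : Measure Y} (k : Y →ᵇ ℂ) : mulOp ν k + mulOp ν (1 - k) = 1 := by
  rw [← mulOp_add, add_sub_cancel, mulOp_one]

theorem HasFinitePropagation.mul {Y : Type*} [MetricSpace Y] [ProperSpace Y] [MeasurableSpace Y]
    [BorelSpace Y] {ν : Measure Y} [IsFiniteMeasureOnCompacts ν] {A B : L2 ν →L[ℂ] L2 ν}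
    (hA : HasFinitePropagation A) (hB : HasFinitePropagation B) :
    HasFinitePropagation (A * B) := by
  obtain ⟨R, hR, hA⟩ := hA
  obtain ⟨S, hS, hB⟩ := hB
  refine ⟨R + S + 2, by positivity, fun f g h => ?_⟩
  obtain ⟨k, hk1, hk2⟩ := exists_cutoff (tsupport f) R
  have h1 : mulOp ν f.toBCF * A * mulOp ν (1 - k) = 0 :=
    HasFinitePropagation.bcf hA _ _ fun x hx y hy => by rw [dist_comm]; exact hk2 y hy x hx
  have h2 : mulOp ν k * B * mulOp ν g.toBCF = 0 :=
    HasFinitePropagation.bcf hB _ _ fun y hy z hz => by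
      obtain ⟨x, hx, hyx⟩ := hk1 y hy
      have := h x hx z hz
      have := dist_triangle x y z
      rw [dist_comm x y] at this
      linarith
  calc mulOp ν f.toBCF * (A * B) * mulOp ν g.toBCF
      = mulOp ν f.toBCF * A * (mulOp ν k + mulOp ν (1 - k)) * B * mulOp ν g.toBCF := by
        rw [mulOp_split, mul_one]; simp only [mul_assoc]
    _ = mulOp ν f.toBCF * A * (mulOp ν k * B * mulOp ν g.toBCF) +
        mulOp ν f.toBCF * A * mulOp ν (1 - k) * (B * mulOp ν g.toBCF) := by noncomm_ring
    _ = 0 := by rw [h1, h2, mul_zero, zero_mul, add_zero]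

theorem HasFinitePropagation.star {Y : Type*} [MetricSpace Y] [ProperSpace Y] [MeasurableSpace Y]
    [BorelSpace Y] {ν : Measure Y} [IsFiniteMeasureOnCompacts ν] {A : L2 ν →L[ℂ] L2 ν}
    (hA : HasFinitePropagation A) : HasFinitePropagation (star A) := by
  obtain ⟨R, hR, hA⟩ := hA
  refine ⟨R, hR, fun f g h => ?_⟩
  have := HasFinitePropagation.bcf hA (Star.star g.toBCF) (Star.star f.toBCF) fun x hx y hy => by
    rw [tsupport_star] at hx hy
    rw [dist_comm]
    exact h y hy x hx
  rw [mulOp_star, mulOp_star] at this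
  rw [← star_eq_zero]
  simpa [mul_assoc] using this

theorem IsSupportedNear.star {Y : Type*} [MetricSpace Y] [ProperSpace Y] [MeasurableSpace Y]
    [BorelSpace Y] {ν : Measure Y} [IsFiniteMeasureOnCompacts ν] {Z : Set Y}
    {A : L2 ν →L[ℂ] L2 ν} (hA : HasFinitePropagation A) (hZ : IsSupportedNear Z A) :
    IsSupportedNear Z (star A) := by
  obtain ⟨S, hS, hA⟩ := hA
  obtain ⟨R, hR, hZ⟩ := hZ
  refine ⟨R + S + 2, by positivity, fun w h => ?_⟩
  obtain ⟨k, hk1, hk2⟩ := exists_cutoff Z R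
  have h1 : A * mulOp ν (1 - k) = 0 := IsSupportedNear.bcf hZ _ hk2
  have h2 : mulOp ν (Star.star (ccBCF w)) * A * mulOp ν k = 0 :=
    HasFinitePropagation.bcf hA _ _ fun x hx y hy => by
      rw [tsupport_star] at hx
      obtain ⟨z, hz, hyz⟩ := hk1 y hy
      have := h x hx z hz
      have := dist_triangle x y z
      linarith
  have h3 : mulOp ν (Star.star (ccBCF w)) * A = 0 := by
    rw [← mul_one (mulOp ν (Star.star (ccBCF w)) * A), ← mulOp_split k, mul_add, h2, mul_assoc, h1,
      mul_zero, add_zero]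
  have h4 : Star.star A * mulOp ν (ccBCF w) = 0 := by
    rw [← star_eq_zero, star_mul, star_star, ← mulOp_star, h3]
  obtain ⟨c, -, hc⟩ := exists_ccL2_eq ν w
  rw [← hc]
  exact DFunLike.congr_fun h4 _

/-- The adjoint of a compact operator is compact. -/
theorem isCompactOperator_star {H : Type*} [NormedAddCommGroup H] [InnerProductSpace ℂ H]
    [CompleteSpace H] {T : H →L[ℂ] H} (hT : IsCompactOperator T) :
    IsCompactOperator ⇑(star T : H →L[ℂ] H) := by
  refine (isCompactOperator_iff_isCompact_closure_image_ball
    ((star T : H →L[ℂ] H) : H →ₗ[ℂ] H) one_pos).2 ?_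
  refine TotallyBounded.isCompact_of_isClosed ?_ isClosed_closure
  refine TotallyBounded.closure ?_
  have hc : IsCompactOperator ((T * star T : H →L[ℂ] H) : H →ₗ[ℂ] H) := hT.comp_clm (star T)
  have hK := (hc.isCompact_closure_image_ball 1).totallyBounded.subset subset_closure
  rw [Metric.totallyBounded_iff]
  intro ε hε
  obtain ⟨t, ht, hfin, hcov⟩ := hK.exists_subset
    (Metric.dist_mem_uniformity (show 0 < ε ^ 2 / 2 by positivity))
  have ht' : ∀ y ∈ t, ∃ z, z ∈ ball (0 : H) 1 ∧ T (star T z) = y := fun y hy => ht hy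
  choose! g hg1 hg2 using ht'
  refine ⟨(fun y => star T (g y)) '' t, hfin.image _, ?_⟩
  rintro _ ⟨x, hx, rfl⟩
  have hx' := hcov (mem_image_of_mem _ hx)
  simp only [mem_iUnion, mem_ofPred_eq, exists_prop] at hx'
  obtain ⟨y, hy, hxy⟩ := hx'
  refine mem_iUnion₂.2 ⟨_, mem_image_of_mem _ hy, ?_⟩
  rw [mem_ball, dist_eq_norm]
  have hgy := hg1 y hy
  have hgy2 : T (star T (g y)) = y := hg2 y hy
  rw [mem_ball_zero_iff] at hx hgy
  set d := x - g y with hd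
  have hdn : ‖d‖ ≤ 2 := (norm_sub_le _ _).trans (by linarith)
  have h1 : ‖T (star T d)‖ < ε ^ 2 / 2 := by
    rw [hd, map_sub, map_sub, hgy2, ← dist_eq_norm]
    exact hxy
  have h2 : ‖star T d‖ ^ 2 ≤ ‖T (star T d)‖ * ‖d‖ := by
    have e : ‖star T d‖ ^ 2 = RCLike.re (inner ℂ (T (star T d)) d) := by
      rw [← ContinuousLinearMap.adjoint_inner_right, ← ContinuousLinearMap.star_eq_adjoint]
      exact norm_sq_eq_re_inner _
    rw [e]
    exact (RCLike.re_le_norm _).trans (norm_inner_le_norm _ _)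
  have h3 : ‖star T d‖ ^ 2 < ε ^ 2 := by
    nlinarith [norm_nonneg (T (star T d)), norm_nonneg d]
  have h4 := lt_of_pow_lt_pow_left₀ 2 hε.le h3
  rw [hd, map_sub] at h4
  exact h4

/-- The algebra of locally compact operators of finite propagation supported near `Z`. -/
def localizedRoeAlgebra₀ {Y : Type*} [MetricSpace Y] [ProperSpace Y] [MeasurableSpace Y]
    [BorelSpace Y] (ν : Measure Y) [IsFiniteMeasureOnCompacts ν] (Z : Set Y) :
    NonUnitalStarSubalgebra ℂ (L2 ν →L[ℂ] L2 ν) where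
  carrier := {A | IsLocallyCompact A ∧ HasFinitePropagation A ∧ IsSupportedNear Z A}
  zero_mem' := ⟨fun f => by
      rw [zero_mul, mul_zero]
      exact ⟨isCompactOperator_zero, isCompactOperator_zero⟩,
    ⟨0, le_rfl, fun f g _ => by simp⟩, ⟨0, le_rfl, fun w _ => by simp⟩⟩
  add_mem' := by
    rintro A B ⟨hA1, ⟨R, hR, hA2⟩, R', hR', hA3⟩ ⟨hB1, ⟨S, hS, hB2⟩, S', hS', hB3⟩
    refine ⟨fun f => ?_, ⟨max R S, by positivity, fun f g h => ?_⟩,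
      ⟨max R' S', by positivity, fun w h => ?_⟩⟩
    · rw [add_mul, mul_add]
      exact ⟨(hA1 f).1.add (hB1 f).1, (hA1 f).2.add (hB1 f).2⟩
    · rw [mul_add, add_mul, hA2 f g fun x hx y hy => (le_max_left _ _).trans (h x hx y hy),
        hB2 f g fun x hx y hy => (le_max_right _ _).trans (h x hx y hy), add_zero]
    · rw [add_apply, hA3 w fun x hx y hy => (le_max_left _ _).trans (h x hx y hy),
        hB3 w fun x hx y hy => (le_max_right _ _).trans (h x hx y hy), add_zero]
  mul_mem' := by
    rintro A B ⟨hA1, hA2, -⟩ ⟨hB1, hB2, S, hS, hB3⟩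
    refine ⟨fun f => ⟨?_, ?_⟩, hA2.mul hB2, S, hS, fun w h => ?_⟩
    · rw [mul_assoc]
      exact (hB1 f).1.clm_comp A
    · rw [← mul_assoc]
      exact (hA1 f).2.comp_clm B
    · change A (B _) = 0
      rw [hB3 w h, map_zero]
  smul_mem' := by
    rintro c A ⟨hA1, ⟨R, hR, hA2⟩, S, hS, hA3⟩
    refine ⟨fun f => ?_, ⟨R, hR, fun f g h => ?_⟩, S, hS, fun w h => ?_⟩
    · rw [smul_mul_assoc, mul_smul_comm]
      exact ⟨(hA1 f).1.smul c, (hA1 f).2.smul c⟩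
    · rw [mul_smul_comm, smul_mul_assoc, hA2 f g h, smul_zero]
    · rw [smul_apply, hA3 w h, smul_zero]
  star_mem' := by
    rintro A ⟨hA1, hA2, hA3⟩
    refine ⟨fun f => ?_, hA2.star, hA3.star hA2⟩
    have h := hA1 (star f)
    rw [mulOp_ccBCF_star] at h
    have h1 := isCompactOperator_star h.1
    have h2 := isCompactOperator_star h.2
    rw [star_mul, star_star] at h1 h2
    exact ⟨h2, h1⟩

/-- The Roe algebra `C*_Y(Z)` of `Y` localised at `Z`: the closure, in the operator norm, of the
locally compact operators of finite propagation that are supported near `Z`. -/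
def localizedRoeAlgebra {Y : Type*} [MetricSpace Y] [ProperSpace Y] [MeasurableSpace Y]
    [BorelSpace Y] (ν : Measure Y) [IsFiniteMeasureOnCompacts ν] (Z : Set Y) :
    NonUnitalStarSubalgebra ℂ (L2 ν →L[ℂ] L2 ν) :=
  (localizedRoeAlgebra₀ ν Z).topologicalClosure

instance isClosed_localizedRoeAlgebra {Y : Type*} [MetricSpace Y] [ProperSpace Y] [MeasurableSpace Y]
    [BorelSpace Y] (ν : Measure Y) [IsFiniteMeasureOnCompacts ν] (Z : Set Y) :
    IsClosed (localizedRoeAlgebra ν Z : Set (L2 ν →L[ℂ] L2 ν)) :=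
  NonUnitalStarSubalgebra.isClosed_topologicalClosure _

/-! ### Index and compressions -/

/-- The index of a Fredholm operator: `dim ker T - dim coker T`. -/
def index {E F : Type*} [AddCommGroup E] [Module ℂ E] [TopologicalSpace E] [AddCommGroup F]
    [Module ℂ F] [TopologicalSpace F] (T : E →L[ℂ] F) : ℤ :=
  (Module.finrank ℂ T.ker : ℤ) - (Module.finrank ℂ (F ⧸ T.range) : ℤ)

/-- The operator on `Hⁿ` given by an `n × n` matrix of operators on `H`. -/
def matrixOp {H : Type*} [NormedAddCommGroup H] [NormedSpace ℂ H] {n : ℕ}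
    (a : Matrix (Fin n) (Fin n) (H →L[ℂ] H)) : (Fin n → H) →L[ℂ] (Fin n → H) :=
  ContinuousLinearMap.pi fun i => ∑ j, (a i j).comp (ContinuousLinearMap.proj j)

/-- The restriction map `Π_P : L²(Y) → L²(P)`. -/
def restrictL2 {Y : Type*} [MeasurableSpace Y] (ν : Measure Y) (P : Set Y) :
    L2 ν →L[ℂ] L2 (ν.restrict P) :=
  LpToLpRestrictCLM Y ℂ ℂ ν 2 P

/-- The compression `Π_P A Π_P^*` of `A` to `L²(P)`; the adjoint `Π_P^*` is the extension by zero. -/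
def compress {Y : Type*} [MeasurableSpace Y] {ν : Measure Y} (P : Set Y) (A : L2 ν →L[ℂ] L2 ν) :
    L2 (ν.restrict P) →L[ℂ] L2 (ν.restrict P) :=
  restrictL2 ν P ∘L A ∘L (restrictL2 ν P).adjoint

theorem restrictL2_coe {Y : Type*} [MeasurableSpace Y] {ν : Measure Y} (P : Set Y) (v : L2 ν) :
    restrictL2 ν P v =ᵐ[ν.restrict P] v := LpToLpRestrictCLM_coeFn ℂ P v

/-! ### Half-spaces and partitions -/

/-- The measure on a closed subset `W` of `X` induced by the measure of `X`. -/
abbrev subMeasure {X : Type*} [MetricSpace X] [MeasurableSpace X] (μ : Measure X)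
    (W : TopologicalSpace.Closeds X) : Measure W :=
  μ.comap (Subtype.val : W → X)

instance properSpace_closeds {X : Type*} [MetricSpace X] [ProperSpace X]
    (W : TopologicalSpace.Closeds X) : ProperSpace W :=
  .of_isClosed W.isClosed

instance subMeasure_isFiniteMeasureOnCompacts {X : Type*} [MetricSpace X] [MeasurableSpace X]
    [BorelSpace X] (μ : Measure X) [IsFiniteMeasureOnCompacts μ] (W : TopologicalSpace.Closeds X) :
    IsFiniteMeasureOnCompacts (subMeasure μ W) where
  lt_top_of_isCompact K hK := by
    have he : MeasurableEmbedding (Subtype.val : W → X) :=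
      MeasurableEmbedding.subtype_coe W.isClosed.measurableSet
    refine (he.comap_apply μ K).trans_lt ?_
    exact (hK.image continuous_subtype_val).measure_lt_top

/-- The Roe algebra `C*_W(∂W)` of `W` localised at its boundary `∂W` in `X`. -/
abbrev boundaryRoeAlgebra {X : Type*} [MetricSpace X] [ProperSpace X] [MeasurableSpace X]
    [BorelSpace X] (μ : Measure X) [IsFiniteMeasureOnCompacts μ] (W : TopologicalSpace.Closeds X) :
    NonUnitalStarSubalgebra ℂ (L2 (subMeasure μ W) →L[ℂ] L2 (subMeasure μ W)) :=
  localizedRoeAlgebra (subMeasure μ W) (Subtype.val ⁻¹' frontier (W : Set X))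

/-- A closed subset `W` of `X` is a half-space if `∂W` has measure zero and the function
`x ↦ d(x, X ∖ W)` is unbounded (the distance to the empty set being `∞`). -/
structure IsHalfSpace {X : Type*} [MetricSpace X] [MeasurableSpace X] (μ : Measure X)
    (W : TopologicalSpace.Closeds X) : Prop where
  measure_frontier : μ (frontier (W : Set X)) = 0
  unbounded_infEDist : ∀ R : ℝ, ∃ x : X, ENNReal.ofReal R < infEDist x (W : Set X)ᶜ

/-- The regular complement `W₋` of a subset `P = W₊` of `W`; the closure is taken in `W`. -/
def regularCompl {X : Type*} [MetricSpace X] {W : TopologicalSpace.Closeds X} (P : Set W) : Set W :=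
  closure Pᶜ

/-- The common boundary `N = W₊ ∩ W₋`, as a subset of `X`. -/
def partitionBoundary {X : Type*} [MetricSpace X] {W : TopologicalSpace.Closeds X} (P : Set W) :
    Set X :=
  Subtype.val '' (P ∩ regularCompl P)

/-- Admissible subsets `P = W₊` of `W`. Here `cthickening R A` is the neighbourhood
`B_R(A) = {x ∈ X : d(x, A) ≤ R}`, taken in `X`. -/
structure IsAdmissible {X : Type*} [MetricSpace X] [MeasurableSpace X] (μ : Measure X)
    (W : TopologicalSpace.Closeds X) (P : Set W) : Prop where
  regularClosed : closure (interior P) = P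
  coarselyExcisive : ∀ R : ℝ, 0 ≤ R → ∃ S : ℝ, 0 ≤ S ∧
    cthickening R (Subtype.val '' P : Set X) ∩ cthickening R (Subtype.val '' regularCompl P : Set X)
      ⊆ cthickening S (partitionBoundary P)
  transverse : ∀ R : ℝ, 0 ≤ R →
    Bornology.IsBounded (cthickening R (W : Set X)ᶜ ∩ cthickening R (partitionBoundary P))
  measure_boundary : μ (partitionBoundary P) = 0

/-- Two admissible subsets `P = W₊` and `Q = W₊'` of `W` are bordant. -/
structure AreBordant {X : Type*} [MetricSpace X] [MeasurableSpace X] (μ : Measure X)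
    (W : TopologicalSpace.Closeds X) (P Q : Set W) : Prop where
  inter : IsAdmissible μ W (P ∩ Q)
  bounded : ∀ R : ℝ, 0 ≤ R →
    Bornology.IsBounded (cthickening R (W : Set X)ᶜ ∩ (Subtype.val '' symmDiff P Q : Set X))

/-- For `u ∈ M_n(C*_W(∂W)⁺)`, the compression `T_u` of `u` to `L²(P)ⁿ`. An element `a + λ` of the
unitization acts on `L²(W)` as `a + λ · 1`. -/
def toeplitz {X : Type*} [MetricSpace X] [ProperSpace X] [MeasurableSpace X]
    [BorelSpace X] {μ : Measure X} [IsFiniteMeasureOnCompacts μ] {W : TopologicalSpace.Closeds X}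
    (P : Set W) {n : ℕ} (u : Matrix (Fin n) (Fin n) (Unitization ℂ (boundaryRoeAlgebra μ W))) :
    (Fin n → L2 ((subMeasure μ W).restrict P)) →L[ℂ]
      (Fin n → L2 ((subMeasure μ W).restrict P)) :=
  matrixOp fun i j =>
    compress P (NonUnitalStarSubalgebra.unitization (boundaryRoeAlgebra μ W) (u i j))

/-- `θ` is the index map of `P = W₊`: for every `n` and every unitary `u ∈ M_n(C*_W(∂W)⁺)`, the
compression `T_u` is a Fredholm operator and `θ [u] = Index T_u`. -/
def IsIndexMap {X : Type*} [MetricSpace X] [ProperSpace X] [MeasurableSpace X]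
    [BorelSpace X] (μ : Measure X) [IsFiniteMeasureOnCompacts μ] (W : TopologicalSpace.Closeds X)
    (P : Set W) (θ : K1 (boundaryRoeAlgebra μ W) →+ ℤ) : Prop :=
  ∀ (n : ℕ) (u : UnitaryMatrix (boundaryRoeAlgebra μ W) n),
    (toeplitz P u.1).IsFredholm ∧ θ (K1.mk u) = index (toeplitz P u.1)

end CoarseIndex

end

/-! Write `p` for multiplication by the indicator function of `P = W₊`. For `a` in the localised Roe
algebra the corner `p a (1 - p)` is compact. By density one may take `a` locally compact, of finite
propagation and supported near `∂W`. Then the corner only involves points close to `∂W`, to `P` and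
to its complement. Coarse excisiveness puts such points near `N`, transversality puts them in a
bounded set, and local compactness finishes (`isCompactOperator_cutProj_mul_cutProj_compl`,
`IsAdmissible.isTransverse`).

Consequently compression to `P` is multiplicative modulo compact operators. So `T_{u*}` is a
parametrix of `T_u`, and the index is additive in `u`, invariant under homotopy and under `u ↦ u ⊕
1`. It therefore factors uniquely through `K₁` (`existsUnique_K1_hom`).

The operators for `P` and `Q` act on different spaces. Both are replaced by operators on `L²(W)ⁿ`
with entries `λ + p a p`, where `λ` is the scalar part: this adds an invertible block on the
complement and keeps the index (`index_compressedToeplitz`). Now `p a p - q a q = (p - q) a p + q a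
(p - q)`, and `p - q` lives on `P Δ Q`. That set is bounded near `∂W`, so the difference is compact
and the indices agree (`index_extendedToeplitz_congr`).

The Fredholm theory needed is that `1 + K` is Fredholm of index zero for compact `K`
(`isFredholm_one_add`), together with its consequences: Atkinson's criterion, invariance under
compact perturbations and local constancy of the index. -/

noncomputable section

namespace CoarseIndex

/-! ### Fredholm operators on Banach spaces -/

section Fredholm

open LinearMap.FiniteRangeSetoid

variable {E F : Type*} [NormedAddCommGroup E] [NormedSpace ℂ E]
  [NormedAddCommGroup F] [NormedSpace ℂ F]

theorem isCompactOperator_of_hasFiniteRange {T : E →L[ℂ] F}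
    (hT : (T : E →ₗ[ℂ] F).HasFiniteRange) : IsCompactOperator T := by
  have : FiniteDimensional ℂ (T : E →ₗ[ℂ] F).range := .of_fg hT
  have : ProperSpace (T : E →ₗ[ℂ] F).range := FiniteDimensional.proper ℂ _
  exact (isCompactOperator_of_locallyCompactSpace_rng
    (T : E →ₗ[ℂ] F).range.subtypeL).comp_clm (T.codRestrict _ fun x => LinearMap.mem_range_self _ x)

theorem exists_isCompactOperator_mul_sub_one {T : E →L[ℂ] E} (hT : T.IsFredholm) :
    ∃ R : E →L[ℂ] E, R.IsFredholm ∧ IsCompactOperator ⇑(R * T - 1 : E →L[ℂ] E) := by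
  obtain ⟨R, hR⟩ := hT.exists_isQuasiInverse
  exact ⟨R, .of_isQuasiInverse hR.symm,
    isCompactOperator_of_hasFiniteRange (equiv_iff_hasFiniteRange.1 hR.1)⟩

theorem isFredholm_mul {S T : E →L[ℂ] E} (hS : S.IsFredholm) (hT : T.IsFredholm) :
    (S * T).IsFredholm := by
  obtain ⟨R, hR⟩ := hS.exists_isQuasiInverse
  obtain ⟨R', hR'⟩ := hT.exists_isQuasiInverse
  exact .of_isQuasiInverse (v := R' * R) (hR'.comp hR)

theorem index_mul {S T : E →L[ℂ] E} (hS : S.IsFredholm) (hT : T.IsFredholm) :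
    index (S * T) = index S + index T := by
  have := hS.finite_ker
  have := hT.finite_ker
  have : FiniteDimensional ℂ (E ⧸ (S : E →ₗ[ℂ] E).range) := hS.finite_coker
  have : FiniteDimensional ℂ (E ⧸ (T : E →ₗ[ℂ] E).range) := hT.finite_coker
  exact LinearMap.index_comp (S : E →ₗ[ℂ] E)

/-- On the kernel `-K` is the identity, so the identity of this closed subspace is compact. -/
theorem finiteDimensional_ker_one_add {K : E →L[ℂ] E} (hK : IsCompactOperator K) :
    FiniteDimensional ℂ (1 + K).ker := by
  have hx : ∀ x ∈ (1 + K).ker, (-K) x = x := fun x hx => by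
    have : x + K x = 0 := hx
    rw [neg_apply]
    exact neg_eq_of_add_eq_zero_left this
  have hc : IsCompactOperator ((-K : E →L[ℂ] E) : E →ₗ[ℂ] E) := hK.neg
  have hr := hc.restrict (V := (1 + K).ker) (fun x h => by
    rw [ContinuousLinearMap.coe_coe, hx x h]; exact h) (1 + K).isClosed_ker
  refine FiniteDimensional.of_isCompactOperator_id (𝕜 := ℂ) ?_
  have he : ∀ f : (1 + K).ker → (1 + K).ker, IsCompactOperator f → (∀ x, (f x : E) = (-K) x) →
      IsCompactOperator (id : (1 + K).ker → (1 + K).ker) := fun f h1 h2 =>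
    (funext fun x => Subtype.ext ((h2 x).trans (hx x x.2)) : f = id) ▸ h1
  exact he _ hr fun _ => rfl

/-! ### Riesz–Schauder theory and stability of the index -/

variable [CompleteSpace E]

/-- The Fredholm alternative at `-1`: injectivity excludes the eigenvalue, so `-1` lies in the
resolvent set. -/
theorem bijective_one_add_of_injective {K : E →L[ℂ] E} (hK : IsCompactOperator K)
    (h : Function.Injective ⇑(1 + K : E →L[ℂ] E)) : Function.Bijective ⇑(1 + K : E →L[ℂ] E) := by
  rcases hK.hasEigenvalue_or_mem_resolventSet (neg_ne_zero.2 (one_ne_zero' ℂ)) with h' | h'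
  · obtain ⟨x, hx, hx0⟩ := h'.exists_hasEigenvector
    refine absurd (h (a₁ := x) (a₂ := 0) ?_) hx0
    have : K x = (-1 : ℂ) • x := Module.End.mem_eigenspace_iff.1 hx
    simp [this]
  · rw [spectrum.mem_resolventSet_iff, ← IsUnit.neg_iff] at h'
    rw [← ContinuousLinearMap.isUnit_iff_bijective]
    convert h' using 1
    simp [add_comm]

/-- Inverting `1 + K` on a closed complement of its kernel gives an injective right inverse `B`. As
`B = 1 - K B` is again the identity plus a compact operator, it is invertible by the injective case,
and `1 + K` is its inverse. -/
theorem bijective_one_add_of_surjective {K : E →L[ℂ] E} (hK : IsCompactOperator K)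
    (h : Function.Surjective ⇑(1 + K : E →L[ℂ] E)) : Function.Bijective ⇑(1 + K : E →L[ℂ] E) := by
  have := finiteDimensional_ker_one_add hK
  obtain ⟨p, hp⟩ := Submodule.ClosedComplemented.of_finiteDimensional (𝕜 := ℂ) (1 + K).ker
  have hker : ∀ x, (1 + K) (p x : E) = 0 := fun x => (p x).2
  have : CompleteSpace p.ker := p.isClosed_ker.completeSpace_coe
  let e : p.ker ≃L[ℂ] E := ContinuousLinearEquiv.ofBijective ((1 + K) ∘L p.ker.subtypeL)
    (LinearMap.ker_eq_bot'.2 fun x hx => by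
      have h1 : p x = 0 := x.2
      have h2 : p x = ⟨x, hx⟩ := hp ⟨x, hx⟩
      rw [h1] at h2
      exact Subtype.ext (congrArg Subtype.val h2).symm)
    (LinearMap.range_eq_top.2 fun y => by
      obtain ⟨x, rfl⟩ := h y
      refine ⟨⟨x - p x, ?_⟩, ?_⟩
      · change p (x - p x) = 0
        rw [map_sub, hp, sub_self]
      · change (1 + K) (x - p x) = (1 + K) x
        rw [map_sub, hker, sub_zero])
  let B : E →L[ℂ] E := p.ker.subtypeL ∘L e.symm
  have hB : (1 + K) * B = 1 := by
    ext y
    exact e.apply_symm_apply y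
  have hB' : B = 1 + -(K * B) := by
    rw [add_mul, one_mul] at hB
    rw [← hB]; abel
  have hinj : Function.Injective B := Subtype.val_injective.comp e.symm.injective
  have hunit : IsUnit B := by
    rw [ContinuousLinearMap.isUnit_iff_bijective, hB']
    refine bijective_one_add_of_injective (hK.comp_clm B).neg ?_
    rwa [← hB']
  rw [← ContinuousLinearMap.isUnit_iff_bijective]
  obtain ⟨b, hb⟩ := hunit
  rw [← hb] at hB
  rw [Units.mul_eq_one_iff_eq_inv.1 hB]
  exact b⁻¹.isUnit

/-- Comparing dimensions as cardinals permits `N` to be a cokernel not yet known to be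
finite-dimensional. -/
theorem exists_linearMap_injective_or_surjective.{w} {k : Type*} [Field k] {M N : Type w}
    [AddCommGroup M] [Module k M] [AddCommGroup N] [Module k N] :
    ∃ f : M →ₗ[k] N, Function.Injective f ∨ Function.Surjective f := by
  rcases le_total (Module.rank k M) (Module.rank k N) with h | h
  · obtain ⟨f, hf⟩ := lift_rank_le_iff_exists_linearMap.1 (Cardinal.lift_le.2 h)
    exact ⟨f, .inl hf⟩
  · obtain ⟨g, hg⟩ := lift_rank_le_iff_exists_linearMap.1 (Cardinal.lift_le.2 h)
    obtain ⟨f, hf⟩ := g.exists_leftInverse_of_injective (LinearMap.ker_eq_bot.2 hg)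
    exact ⟨f, .inr fun y => ⟨g y, LinearMap.congr_fun hf y⟩⟩

/-- Take `ψ : ker S → coker S` injective or surjective, and let the finite-rank operator `D` project
to `ker S` and then apply a lift of `ψ`. Then `S + D` is injective or surjective accordingly, hence
bijective by the two lemmas on `1 + K`. This forces `ψ` to be bijective, so kernel and cokernel have
equal dimension. Since `S` is a unit minus a finite-rank operator, it is Fredholm. -/
theorem isFredholm_one_add {K : E →L[ℂ] E} (hK : IsCompactOperator K) :
    (1 + K).IsFredholm ∧ index (1 + K) = 0 := by
  set S := 1 + K with hS
  have := finiteDimensional_ker_one_add hK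
  obtain ⟨p, hp⟩ := Submodule.ClosedComplemented.of_finiteDimensional (𝕜 := ℂ) S.ker
  have hker : ∀ x : S.ker, S (x : E) = 0 := fun x => x.2
  obtain ⟨ψ, hψ⟩ := exists_linearMap_injective_or_surjective (k := ℂ) (M := S.ker)
    (N := E ⧸ S.range)
  obtain ⟨s, hs⟩ := S.range.mkQ.exists_rightInverse_of_surjective S.range.range_mkQ
  have hs' : ∀ c, S.range.mkQ (s c) = c := LinearMap.congr_fun hs
  have hSq : ∀ x, S.range.mkQ (S x) = 0 := fun x =>
    (Submodule.Quotient.mk_eq_zero _).2 ⟨x, rfl⟩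
  let φ : S.ker →L[ℂ] E := LinearMap.toContinuousLinearMap (s ∘ₗ ψ)
  have hφ : ∀ x, S.range.mkQ (φ x) = ψ x := fun x => hs' _
  let D : E →L[ℂ] E := φ ∘L p
  have hDr : (D : E →ₗ[ℂ] E).HasFiniteRange :=
    LinearMap.HasFiniteRange.comp_right (v := (φ : S.ker →ₗ[ℂ] E)) .of_finite_dom _
  have hD : IsCompactOperator D := isCompactOperator_of_hasFiniteRange hDr
  -- Modulo the range of `S`, the operator `S + D` is `ψ ∘ p`.
  have hGq : ∀ x, S.range.mkQ ((S + D) x) = ψ (p x) := fun x => by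
    rw [add_apply, map_add, hSq, zero_add]
    exact hφ _
  have hbij : Function.Bijective ⇑(S + D : E →L[ℂ] E) := by
    rcases hψ with hψ | hψ
    · rw [hS, add_assoc]
      refine bijective_one_add_of_injective (hK.add hD) ?_
      rw [← add_assoc, ← hS]
      refine (injective_iff_map_eq_zero (S + D)).2 fun x hx => ?_
      have h1 : p x = 0 := hψ (by rw [← hGq, hx, map_zero, map_zero])
      have h2 : S x = 0 := by
        have : S x + φ (p x) = 0 := hx
        rwa [h1, map_zero, add_zero] at this
      have h3 := hp ⟨x, h2⟩
      rw [h1] at h3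
      exact (congrArg Subtype.val h3).symm
    · rw [hS, add_assoc]
      refine bijective_one_add_of_surjective (hK.add hD) ?_
      rw [← add_assoc, ← hS]
      intro y
      obtain ⟨n, hn⟩ := hψ (S.range.mkQ y)
      obtain ⟨x, hx⟩ : y - φ n ∈ S.range := by
        rw [← Submodule.Quotient.mk_eq_zero]
        exact (map_sub S.range.mkQ _ _).trans (by rw [hφ, hn, sub_self])
      -- The kernel component of `x` is exchanged for `n`: `S` does not notice, while `D` now
      -- contributes `φ n`.
      refine ⟨x - p x + n, ?_⟩
      have h1 : p (x - p x + n) = n := by rw [map_add, map_sub, hp, hp, sub_self, zero_add]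
      change S (x - p x + n) + φ (p (x - p x + n)) = y
      rw [h1, map_add, map_sub, hker, hker, sub_zero, add_zero]
      exact (sub_eq_iff_eq_add.1 hx.symm).symm
  have hψb : Function.Bijective ψ := by
    constructor
    · refine (injective_iff_map_eq_zero ψ).2 fun n hn => ?_
      obtain ⟨x, hx⟩ : φ n ∈ S.range := by
        rw [← Submodule.Quotient.mk_eq_zero]
        exact (hφ n).trans hn
      have hx : S x = φ n := hx
      -- Here `D` contributes `φ n` and `S` contributes `-S x = -φ n`. Applying `p` to the vanishing
      -- vector returns `n = 0`.
      have : (S + D) ((n : E) - (x - p x)) = 0 := by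
        change S (n - (x - p x)) + φ (p (n - (x - p x))) = 0
        simp only [map_sub, hp, hker, hx]
        simp
      have h1 := congrArg p ((injective_iff_map_eq_zero (S + D)).1 hbij.1 _ this)
      rwa [map_sub, map_sub, hp, hp, sub_self, sub_zero, map_zero] at h1
    · intro c
      obtain ⟨y, rfl⟩ := S.range.mkQ_surjective c
      obtain ⟨x, rfl⟩ := hbij.2 y
      exact ⟨p x, (hGq x).symm⟩
  refine ⟨?_, ?_⟩
  · obtain ⟨g, hg⟩ := (ContinuousLinearMap.isUnit_iff_bijective).2 hbij
    have hSg : S = (g : E →L[ℂ] E) - D := by rw [hg, add_sub_cancel_right]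
    refine .of_isQuasiInverse (v := (↑g⁻¹ : E →L[ℂ] E))
      ⟨equiv_iff_hasFiniteRange.2 ?_, equiv_iff_hasFiniteRange.2 ?_⟩
    · have h1 : (↑g⁻¹ : E →L[ℂ] E) * S - 1 = -((↑g⁻¹ : E →L[ℂ] E) * D) := by
        rw [hSg, mul_sub, Units.inv_mul]; abel
      change LinearMap.HasFiniteRange (((↑g⁻¹ : E →L[ℂ] E) * S - 1 : E →L[ℂ] E) : E →ₗ[ℂ] E)
      rw [h1]
      exact (hDr.comp_left ((↑g⁻¹ : E →L[ℂ] E) : E →ₗ[ℂ] E)).neg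
    · have h1 : S * (↑g⁻¹ : E →L[ℂ] E) - 1 = -(D * (↑g⁻¹ : E →L[ℂ] E)) := by
        rw [hSg, sub_mul, Units.mul_inv]; abel
      change LinearMap.HasFiniteRange ((S * (↑g⁻¹ : E →L[ℂ] E) - 1 : E →L[ℂ] E) : E →ₗ[ℂ] E)
      rw [h1]
      exact (hDr.comp_right ((↑g⁻¹ : E →L[ℂ] E) : E →ₗ[ℂ] E)).neg
  · rw [index, sub_eq_zero]
    exact_mod_cast (LinearEquiv.ofBijective ψ hψb).finrank_eq

/-- Atkinson's criterion. Both `R T` and `T R` are Fredholm, with quasi-inverses `V` and `V'`. Thus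
`V R` is a left and `R V'` a right quasi-inverse of `T`; they agree modulo finite rank by the usual
associativity argument. -/
theorem isFredholm_of_parametrix {T R : E →L[ℂ] E} (h1 : IsCompactOperator ⇑(R * T - 1 : E →L[ℂ] E))
    (h2 : IsCompactOperator ⇑(T * R - 1 : E →L[ℂ] E)) : T.IsFredholm := by
  have f1 := (isFredholm_one_add h1).1
  have f2 := (isFredholm_one_add h2).1
  rw [add_sub_cancel] at f1 f2
  obtain ⟨V, hV⟩ := f1.exists_isQuasiInverse
  obtain ⟨V', hV'⟩ := f2.exists_isQuasiInverse
  let t : E →ₗ[ℂ] E := T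
  let a : E →ₗ[ℂ] E := V * R
  let b : E →ₗ[ℂ] E := R * V'
  have e1 : a ∘ₗ t ≈ .id := hV.1
  have e2 : t ∘ₗ b ≈ .id := hV'.2
  have e3 : a ≈ b := calc
    a = a ∘ₗ .id := rfl
    _ ≈ a ∘ₗ (t ∘ₗ b) := equiv_comp_left (Setoid.symm e2)
    _ = (a ∘ₗ t) ∘ₗ b := rfl
    _ ≈ .id ∘ₗ b := equiv_comp_right e1
    _ = b := rfl
  have e4 : t ∘ₗ a ≈ .id := Setoid.trans (equiv_comp_left e3) e2
  exact .of_isQuasiInverse (v := V * R) ⟨e1, e4⟩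

theorem isFredholm_of_isUnit {T : E →L[ℂ] E} (hT : IsUnit T) : T.IsFredholm := by
  obtain ⟨t, rfl⟩ := hT
  refine isFredholm_of_parametrix (R := (↑t⁻¹ : E →L[ℂ] E)) ?_ ?_
  · rw [Units.inv_mul, sub_self]; exact isCompactOperator_zero
  · rw [Units.mul_inv, sub_self]; exact isCompactOperator_zero

theorem index_of_isUnit {T : E →L[ℂ] E} (hT : IsUnit T) : index T = 0 :=
  LinearEquiv.index_eq_zero (e := LinearEquiv.ofBijective (T : E →ₗ[ℂ] E)
    ((ContinuousLinearMap.isUnit_iff_bijective).1 hT))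

theorem index_isUnit_add {V K : E →L[ℂ] E} (hV : IsUnit V) (hK : IsCompactOperator K) :
    index (V + K) = 0 := by
  have hf := isFredholm_of_isUnit hV
  have h0 := index_of_isUnit hV
  obtain ⟨v, rfl⟩ := hV
  have hc : IsCompactOperator ((↑v⁻¹ : E →L[ℂ] E) * K) := hK.clm_comp (↑v⁻¹ : E →L[ℂ] E)
  have h := isFredholm_one_add hc
  have e : (v : E →L[ℂ] E) + K = v * (1 + (↑v⁻¹ : E →L[ℂ] E) * K) := by
    rw [mul_add, mul_one, Units.mul_inv_cancel_left]
  rw [e, index_mul hf h.1, h.2, h0, add_zero]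

/-- A parametrix `R` of `S` is also one for `T` on the left, so both indices equal `-index R`. -/
theorem index_eq_of_isCompactOperator_sub {S T : E →L[ℂ] E} (hS : S.IsFredholm)
    (hT : T.IsFredholm) (h : IsCompactOperator ⇑(T - S : E →L[ℂ] E)) : index S = index T := by
  obtain ⟨R, hR, hc⟩ := exists_isCompactOperator_mul_sub_one hS
  have h1 : index R + index S = 0 := by
    rw [← index_mul hR hS, ← add_sub_cancel 1 (R * S)]
    exact index_isUnit_add isUnit_one hc
  have h2 : index R + index T = 0 := by
    rw [← index_mul hR hT]
    have e : R * T = 1 + ((R * S - 1) + R * (T - S)) := by rw [mul_sub]; abel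
    rw [e]
    exact index_isUnit_add isUnit_one (hc.add (h.clm_comp R))
  omega

/-- The index is locally constant on Fredholm operators. -/
theorem eventually_index_eq {S : E →L[ℂ] E} (hS : S.IsFredholm) :
    ∀ᶠ T in nhds S, T.IsFredholm → index T = index S := by
  obtain ⟨R, hR, hc⟩ := exists_isCompactOperator_mul_sub_one hS
  have h1 : index R + index S = 0 := by
    rw [← index_mul hR hS, ← add_sub_cancel 1 (R * S)]
    exact index_isUnit_add isUnit_one hc
  have hcont : ContinuousAt (fun T : E →L[ℂ] E => 1 + R * (T - S)) S := by fun_prop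
  have hu : ∀ᶠ T in nhds S, IsUnit (1 + R * (T - S)) := by
    refine hcont.eventually (Units.isOpen.mem_nhds ?_)
    simp
  filter_upwards [hu] with T hT hTf
  have h2 : index R + index T = 0 := by
    rw [← index_mul hR hTf]
    -- For `T` close to `S` the first two summands form a unit, and the last is compact; hence `R *
    -- T` has index zero.
    have e : R * T = 1 + R * (T - S) + (R * S - 1) := by rw [mul_sub]; abel
    rw [e]
    exact index_isUnit_add hT hc
  omega

theorem index_eq_of_continuous {X : Type*} [TopologicalSpace X] [PreconnectedSpace X]
    {T : X → E →L[ℂ] E} (hT : Continuous T) (hf : ∀ x, (T x).IsFredholm) (x y : X) :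
    index (T x) = index (T y) := by
  have : IsLocallyConstant fun x => index (T x) := by
    rw [IsLocallyConstant.iff_eventually_eq]
    intro x
    filter_upwards [hT.continuousAt.eventually (eventually_index_eq (hf x))] with y hy
    exact hy (hf y)
  exact this.apply_eq_of_preconnectedSpace x y

end Fredholm

/-- An operator `S` on `H` that is conjugate to `T ⊕ S'` with `S'` invertible has the same index as
`T`. Here `r` and `s` are the projection to and the inclusion of the domain of `T`, and `L` is
the inverse of `S'`. -/
theorem index_eq_of_splitting {H H' : Type*} [AddCommGroup H] [Module ℂ H] [TopologicalSpace H]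
    [AddCommGroup H'] [Module ℂ H'] [TopologicalSpace H'] {S : H →L[ℂ] H} {T : H' →L[ℂ] H'}
    (r : H →ₗ[ℂ] H') (s : H' →ₗ[ℂ] H) (L : H → H) (hrs : ∀ x, r (s x) = x)
    (hs : ∀ x, S (s x) = s (T x)) (hr : ∀ x, r (S x) = T (r x))
    (hSL : ∀ x, r x = 0 → S (L x) = x) (hLS : ∀ x, r x = 0 → L (S x) = x) :
    index S = index T := by
  have hL0 : L 0 = 0 := by simpa using hLS 0 (map_zero r)
  have hk : Module.finrank ℂ S.ker = Module.finrank ℂ T.ker := by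
    refine LinearEquiv.finrank_eq (LinearEquiv.ofBijective (r.restrict (p := S.ker) (q := T.ker)
      fun x hx => ?_) ⟨?_, ?_⟩)
    · change T (r x) = 0
      rw [← hr, show S x = 0 from hx, map_zero]
    · refine (injective_iff_map_eq_zero _).2 fun x hx => Subtype.ext ?_
      rw [← hLS x (congrArg Subtype.val hx), show S x = 0 from x.2, hL0]
      rfl
    · intro y
      refine ⟨⟨s y, ?_⟩, Subtype.ext (hrs y)⟩
      change S (s y) = 0
      rw [hs, show T y = 0 from y.2, map_zero]
  have hc : Module.finrank ℂ (H ⧸ S.range) = Module.finrank ℂ (H' ⧸ T.range) := by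
    refine (LinearEquiv.finrank_eq (LinearEquiv.ofBijective
      (T.range.mapQ S.range s ?_) ⟨?_, ?_⟩)).symm
    · rintro _ ⟨x, rfl⟩
      exact ⟨s x, hs x⟩
    · refine (injective_iff_map_eq_zero _).2 fun c hc => ?_
      obtain ⟨y, rfl⟩ := Submodule.Quotient.mk_surjective _ c
      rw [Submodule.mapQ_apply, Submodule.Quotient.mk_eq_zero] at hc
      obtain ⟨x, hx⟩ := hc
      refine (Submodule.Quotient.mk_eq_zero _).2 ⟨r x, ?_⟩
      change T (r x) = y
      rw [← hr, show S x = s y from hx, hrs]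
    · intro c
      obtain ⟨y, rfl⟩ := Submodule.Quotient.mk_surjective _ c
      -- The vectors `y` and `s (r y)` differ by an element of `ker r`, on which `L` provides
      -- preimages under `S`.
      refine ⟨Submodule.Quotient.mk (r y), ?_⟩
      rw [Submodule.mapQ_apply, eq_comm, Submodule.Quotient.eq]
      exact ⟨L (y - s (r y)), hSL _ (by rw [map_sub, hrs, sub_self])⟩
  rw [index, index, hk, hc]

/-! ### Matrices of operators -/

section MatrixOp

variable {H : Type*} [NormedAddCommGroup H] [NormedSpace ℂ H] {n : ℕ}

theorem matrixOp_apply (a : Matrix (Fin n) (Fin n) (H →L[ℂ] H)) (v : Fin n → H) (i : Fin n) :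
    matrixOp a v i = ∑ j, a i j (v j) := by
  simp [matrixOp]

theorem matrixOp_sub (a b : Matrix (Fin n) (Fin n) (H →L[ℂ] H)) :
    matrixOp (a - b) = matrixOp a - matrixOp b := by
  ext v i
  simp [matrixOp_apply, Finset.sum_sub_distrib]

theorem matrixOp_mul (a b : Matrix (Fin n) (Fin n) (H →L[ℂ] H)) :
    matrixOp (a * b) = matrixOp a * matrixOp b := by
  ext1 v
  funext i
  change _ = matrixOp a (matrixOp b v) i
  simp only [matrixOp_apply, Matrix.mul_apply, sum_apply, map_sum,
    mul_apply_eq_comp]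
  exact Finset.sum_comm

theorem matrixOp_one : matrixOp (1 : Matrix (Fin n) (Fin n) (H →L[ℂ] H)) = 1 := by
  ext1 v
  funext i
  rw [matrixOp_apply, Finset.sum_eq_single i]
  · simp
  · intro j _ hj
    simp [Matrix.one_apply_ne hj.symm]
  · simp

/-- Reduces continuity and compactness of `matrixOp a` to the entries of `a`. -/
theorem matrixOp_eq_sum (a : Matrix (Fin n) (Fin n) (H →L[ℂ] H)) :
    matrixOp a = ∑ i, ∑ j, (ContinuousLinearMap.single ℂ (fun _ : Fin n => H) i) ∘L
      (a i j) ∘L (ContinuousLinearMap.proj j) := by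
  ext1 v
  funext k
  simp only [matrixOp_apply, sum_apply, Finset.sum_apply, ContinuousLinearMap.comp_apply,
    ContinuousLinearMap.single_apply, ContinuousLinearMap.proj_apply, Pi.single_apply]
  rw [Finset.sum_comm]
  simp

theorem continuous_matrixOp {X : Type*} [TopologicalSpace X]
    {a : X → Matrix (Fin n) (Fin n) (H →L[ℂ] H)} (ha : ∀ i j, Continuous fun x => a x i j) :
    Continuous fun x => matrixOp (a x) := by
  simp only [matrixOp_eq_sum]
  exact continuous_finsetSum _ fun i _ => continuous_finsetSum _ fun j _ =>
    continuous_const.clm_comp ((ha i j).clm_comp continuous_const)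

theorem isCompactOperator_sum {ι E F : Type*} [NormedAddCommGroup E] [NormedSpace ℂ E]
    [NormedAddCommGroup F] [NormedSpace ℂ F] {s : Finset ι} {f : ι → E →L[ℂ] F}
    (hf : ∀ i ∈ s, IsCompactOperator (f i)) : IsCompactOperator ⇑(∑ i ∈ s, f i) :=
  sum_mem (S := compactOperator (RingHom.id ℂ) E F) hf

theorem isCompactOperator_matrixOp {a : Matrix (Fin n) (Fin n) (H →L[ℂ] H)}
    (ha : ∀ i j, IsCompactOperator (a i j)) : IsCompactOperator (matrixOp a) := by
  rw [matrixOp_eq_sum]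
  exact isCompactOperator_sum fun i _ => isCompactOperator_sum fun j _ =>
    ((ha i j).comp_clm (ContinuousLinearMap.proj (R := ℂ) (φ := fun _ : Fin n => H) j)).clm_comp
      (ContinuousLinearMap.single ℂ (fun _ : Fin n => H) i)

/-- On the added coordinates the padded operator is the identity, so `index_eq_of_splitting` applies
with `L = id`. -/
theorem index_matrixOp_padMatrix {m : ℕ} (h : n ≤ m) (a : Matrix (Fin n) (Fin n) (H →L[ℂ] H)) :
    index (matrixOp (padMatrix h a)) = index (matrixOp a) := by
  set e := finSumEquiv h
  have key : ∀ (v : Fin m → H) (k), matrixOp (padMatrix h a) v (e k) =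
      ∑ l, Matrix.fromBlocks a 0 0 1 k l (v (e l)) := fun v k => by
    rw [matrixOp_apply, ← e.sum_comp]
    simp [padMatrix, e]
  have hl : ∀ (v : Fin m → H) (i), matrixOp (padMatrix h a) v (e (.inl i)) =
      ∑ j, a i j (v (e (.inl j))) := fun v i => by
    rw [key, Fintype.sum_sum_type]; simp
  have hr : ∀ (v : Fin m → H) (i), matrixOp (padMatrix h a) v (e (.inr i)) = v (e (.inr i)) :=
    fun v i => by
    rw [key, Fintype.sum_sum_type, Finset.sum_eq_single (a := i) (s := Finset.univ)
      (f := fun x => Matrix.fromBlocks a 0 0 1 (Sum.inr i) (Sum.inr x) (v (e (Sum.inr x))))]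
    · simp
    · intro j _ hj
      simp [Matrix.one_apply_ne hj.symm]
    · simp
  let r : (Fin m → H) →ₗ[ℂ] (Fin n → H) := LinearMap.funLeft ℂ H fun i => e (.inl i)
  let s : (Fin n → H) →ₗ[ℂ] (Fin m → H) :=
    { toFun := fun w k => Sum.elim w 0 (e.symm k)
      map_add' := fun v w => by
        ext k
        obtain ⟨k | k, rfl⟩ := e.surjective k <;> simp
      map_smul' := fun c v => by
        ext k
        obtain ⟨k | k, rfl⟩ := e.surjective k <;> simp }
  have hs : ∀ w k, s w (e k) = Sum.elim w 0 k := fun w k => by simp [s]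
  have hfix : ∀ v, r v = 0 → matrixOp (padMatrix h a) v = v := fun v hv => by
    have hv' : ∀ j, v (e (.inl j)) = 0 := fun j => congrFun hv j
    ext k
    obtain ⟨k | k, rfl⟩ := e.surjective k
    · rw [hl, hv']
      simp [hv']
    · exact hr v k
  refine index_eq_of_splitting r s id (fun w => ?_) (fun w => ?_) (fun v => ?_) hfix hfix
  · ext i
    exact hs w _
  · ext k
    obtain ⟨k | k, rfl⟩ := e.surjective k
    · rw [hl, hs, Sum.elim_inl, matrixOp_apply]
      simp [hs]
    · rw [hr, hs, hs]; rfl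
  · ext i
    exact (hl v i).trans (matrixOp_apply _ _ _).symm

end MatrixOp

/-! ### Multiplication by indicator functions -/

section Indicator

variable {Y : Type*} [MeasurableSpace Y] {ν : Measure Y} {P Q : Set Y}

theorem restrictL2_adjoint_coe (hP : MeasurableSet P) (w : L2 (ν.restrict P)) :
    (restrictL2 ν P).adjoint w =ᵐ[ν] P.indicator w := by
  have hw : MemLp (P.indicator w) 2 ν := (memLp_indicator_iff_restrict hP).2 (Lp.memLp w)
  have : (restrictL2 ν P).adjoint w = hw.toLp := by
    refine ext_inner_right ℂ fun v => ?_
    rw [ContinuousLinearMap.adjoint_inner_left, L2.inner_def, L2.inner_def]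
    calc ∫ y, inner ℂ (w y) (restrictL2 ν P v y) ∂ν.restrict P
        = ∫ y in P, inner ℂ (w y) (v y) ∂ν := by
          refine integral_congr_ae ?_
          filter_upwards [restrictL2_coe P v] with y hy
          rw [hy]
      _ = ∫ y, P.indicator (fun y => inner ℂ (w y) (v y)) y ∂ν := (integral_indicator hP).symm
      _ = ∫ y, inner ℂ ((hw.toLp : L2 ν) y) (v y) ∂ν := by
          refine integral_congr_ae ?_
          filter_upwards [hw.coeFn_toLp] with y hy
          rw [hy]
          by_cases h : y ∈ P <;> simp [h]
  rw [this]
  exact hw.coeFn_toLp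

theorem restrictL2_adjoint_apply (hP : MeasurableSet P) (w : L2 (ν.restrict P)) :
    restrictL2 ν P ((restrictL2 ν P).adjoint w) = w := by
  refine Lp.ext ?_
  filter_upwards [restrictL2_coe P ((restrictL2 ν P).adjoint w),
    ae_restrict_of_ae (restrictL2_adjoint_coe hP w), ae_restrict_mem hP] with y h1 h2 h3
  rw [h1, h2, indicator_of_mem h3]

/-- The multiplication operator on `L²(Y)` by the indicator function of `P`. -/
def cutProj (ν : Measure Y) (P : Set Y) : L2 ν →L[ℂ] L2 ν :=
  (restrictL2 ν P).adjoint ∘L restrictL2 ν P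

theorem cutProj_coe (hP : MeasurableSet P) (v : L2 ν) : cutProj ν P v =ᵐ[ν] P.indicator v := by
  have h := (ae_restrict_iff' hP).1 (restrictL2_coe (ν := ν) P v)
  filter_upwards [restrictL2_adjoint_coe hP (restrictL2 ν P v), h] with y h1 h2
  change (restrictL2 ν P).adjoint (restrictL2 ν P v) y = _
  rw [h1]
  by_cases hy : y ∈ P
  · simp [hy, h2 hy]
  · simp [hy]

theorem star_cutProj : star (cutProj ν P) = cutProj ν P := by
  rw [ContinuousLinearMap.star_eq_adjoint, cutProj, ContinuousLinearMap.adjoint_comp,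
    ContinuousLinearMap.adjoint_adjoint]

theorem cutProj_mul_cutProj (hP : MeasurableSet P) (hQ : MeasurableSet Q) :
    cutProj ν P * cutProj ν Q = cutProj ν (P ∩ Q) := by
  ext1 v
  refine Lp.ext ?_
  filter_upwards [cutProj_coe hP (cutProj ν Q v), cutProj_coe hQ v,
    cutProj_coe (hP.inter hQ) v] with y h1 h2 h3
  rw [h3, mul_apply_eq_comp, h1, ← indicator_indicator]
  by_cases hy : y ∈ P <;> simp [hy, h2]

theorem cutProj_mul_self (hP : MeasurableSet P) : cutProj ν P * cutProj ν P = cutProj ν P := by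
  rw [cutProj_mul_cutProj hP hP, inter_self]

theorem cutProj_compl (hP : MeasurableSet P) : cutProj ν Pᶜ = 1 - cutProj ν P := by
  ext1 v
  refine Lp.ext ?_
  filter_upwards [cutProj_coe hP v, cutProj_coe hP.compl v,
    Lp.coeFn_sub v (cutProj ν P v)] with y h1 h2 h3
  rw [h2, sub_apply, one_apply_eq_self, h3, Pi.sub_apply, h1]
  by_cases hy : y ∈ P <;> simp [hy]

/-- The difference of the two indicator functions vanishes off `P Δ Q`. -/
theorem cutProj_sub_mul_symmDiff (hP : MeasurableSet P) (hQ : MeasurableSet Q) :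
    (cutProj ν P - cutProj ν Q) * cutProj ν (symmDiff P Q) = cutProj ν P - cutProj ν Q := by
  ext1 v
  refine Lp.ext ?_
  set D := symmDiff P Q
  filter_upwards [cutProj_coe hP v, cutProj_coe hQ v, cutProj_coe hP (cutProj ν D v),
    cutProj_coe hQ (cutProj ν D v), cutProj_coe (hP.symmDiff hQ) v,
    Lp.coeFn_sub (cutProj ν P v) (cutProj ν Q v),
    Lp.coeFn_sub (cutProj ν P (cutProj ν D v)) (cutProj ν Q (cutProj ν D v))]
    with y h1 h2 h3 h4 h5 h6 h7
  rw [mul_apply_eq_comp, sub_apply, sub_apply, h6, h7, Pi.sub_apply, Pi.sub_apply,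
    h1, h2, h3, h4]
  by_cases hy : y ∈ P <;> by_cases hy' : y ∈ Q <;> simp [hy, hy', h5, D, mem_symmDiff]

theorem symmDiff_mul_cutProj_sub (hP : MeasurableSet P) (hQ : MeasurableSet Q) :
    cutProj ν (symmDiff P Q) * (cutProj ν P - cutProj ν Q) = cutProj ν P - cutProj ν Q := by
  have := congrArg star (cutProj_sub_mul_symmDiff (ν := ν) hP hQ)
  rwa [star_mul, star_sub, star_cutProj, star_cutProj, star_cutProj] at this

variable [TopologicalSpace Y] [OpensMeasurableSpace Y]

theorem mulOp_mul_cutProj_comm (hP : MeasurableSet P) (f : Y →ᵇ ℂ) :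
    mulOp ν f * cutProj ν P = cutProj ν P * mulOp ν f := by
  ext1 v
  refine Lp.ext ?_
  filter_upwards [cutProj_coe hP v, cutProj_coe hP (mulOp ν f v), mulOp_coe f v,
    mulOp_coe f (cutProj ν P v)] with y h1 h2 h3 h4
  rw [mul_apply_eq_comp, mul_apply_eq_comp, h2, h4, h1]
  by_cases hy : y ∈ P <;> simp [hy, h3]

theorem mulOp_mul_cutProj_congr (hP : MeasurableSet P) {f g : Y →ᵇ ℂ}
    (hfg : ∀ y ∈ P, f y = g y) : mulOp ν f * cutProj ν P = mulOp ν g * cutProj ν P := by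
  ext1 v
  refine Lp.ext ?_
  filter_upwards [cutProj_coe hP v, mulOp_coe f (cutProj ν P v),
    mulOp_coe g (cutProj ν P v)] with y h1 h3 h4
  rw [mul_apply_eq_comp, mul_apply_eq_comp, h3, h4, h1]
  by_cases hy : y ∈ P
  · rw [hfg y hy]
  · simp [hy]

theorem mulOp_mul_cutProj_of_eq_one (hP : MeasurableSet P) {f : Y →ᵇ ℂ}
    (hf : ∀ y ∈ P, f y = 1) : mulOp ν f * cutProj ν P = cutProj ν P := by
  rw [mulOp_mul_cutProj_congr hP (g := 1) hf, mulOp_one, one_mul]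

end Indicator

/-! ### Compactness of truncated operators in the localised Roe algebra -/

section Truncation

theorem mul_mulOp_of_mul_compl_eq_zero {Y : Type*} [TopologicalSpace Y] [MeasurableSpace Y]
    [OpensMeasurableSpace Y] {ν : Measure Y} {B : L2 ν →L[ℂ] L2 ν} {f : Y →ᵇ ℂ}
    (h : B * mulOp ν (1 - f) = 0) : B * mulOp ν f = B := by
  calc B * mulOp ν f = B * mulOp ν f + B * mulOp ν (1 - f) := by rw [h, add_zero]
    _ = B := by rw [← mul_add, mulOp_split, mul_one]

/-- `exists_cutoff`, with the value of the cut-off function on `S`. -/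
theorem exists_cutoff_one {Y : Type*} [MetricSpace Y] (S : Set Y) {r : ℝ} (hr : 0 < r) :
    ∃ k : Y →ᵇ ℂ, (∀ y ∈ tsupport k, ∃ s ∈ S, dist y s < r + 2) ∧
      (∀ y ∈ tsupport (1 - k : Y →ᵇ ℂ), ∀ s ∈ S, r ≤ dist y s) ∧ ∀ y ∈ S, k y = 1 := by
  obtain ⟨k, h1, h2⟩ := exists_cutoff S r
  refine ⟨k, h1, h2, fun y hy => ?_⟩
  by_contra hne
  have h : y ∈ tsupport (1 - k : Y →ᵇ ℂ) := subset_tsupport _ (by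
    rw [Function.mem_support]
    exact sub_ne_zero.2 (Ne.symm hne))
  have := h2 y h y hy
  rw [dist_self] at this
  linarith

theorem exists_ccBCF_eq_one {Y : Type*} [MetricSpace Y] [ProperSpace Y] {B : Set Y}
    (hB : Bornology.IsBounded B) : ∃ c : C_c(Y, ℂ), ∀ y ∈ B, ccBCF c y = 1 := by
  obtain ⟨f, h1, -, h3, -⟩ := exists_continuous_one_zero_of_isCompact
    (s := closure B) (t := ∅) hB.isCompact_closure isClosed_empty (by simp)
  refine ⟨⟨⟨fun y => (f y : ℂ), by fun_prop⟩, ?_⟩, ?_⟩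
  · exact h3.comp_left (g := fun r : ℝ => (r : ℂ)) (by simp)
  · intro y hy
    have : f y = 1 := h1 (subset_closure hy)
    change ((f y : ℝ) : ℂ) = 1
    rw [this]
    simp

theorem isCompactOperator_mul_mulOp {Y : Type*} [MetricSpace Y] [ProperSpace Y]
    [MeasurableSpace Y] [BorelSpace Y] {ν : Measure Y} {A : L2 ν →L[ℂ] L2 ν}
    (hA : IsLocallyCompact A) {f : Y →ᵇ ℂ} (hf : Bornology.IsBounded (tsupport f)) :
    IsCompactOperator ⇑(A * mulOp ν f : L2 ν →L[ℂ] L2 ν) := by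
  obtain ⟨c, hc⟩ := exists_ccBCF_eq_one hf
  have e : ccBCF c * f = f := by
    ext y
    by_cases hy : y ∈ tsupport f
    · simp [hc y hy]
    · simp [image_eq_zero_of_notMem_tsupport hy]
  rw [← e, mulOp_mul, ← mul_assoc]
  exact (hA c).1.comp_clm (mulOp ν f)

variable {Y : Type*} [MetricSpace Y] [ProperSpace Y] [MeasurableSpace Y] [BorelSpace Y]
  {ν : Measure Y} [IsFiniteMeasureOnCompacts ν] {Z P D : Set Y}

/-- Compact operators are norm closed and `A ↦ L * A * R` is continuous, so the dense subalgebra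
suffices. -/
theorem isCompactOperator_of_mem_localizedRoeAlgebra (L R : L2 ν →L[ℂ] L2 ν)
    (h : ∀ A ∈ localizedRoeAlgebra₀ ν Z, IsCompactOperator ⇑(L * A * R : L2 ν →L[ℂ] L2 ν))
    {A : L2 ν →L[ℂ] L2 ν} (hA : A ∈ localizedRoeAlgebra ν Z) :
    IsCompactOperator ⇑(L * A * R : L2 ν →L[ℂ] L2 ν) := by
  have hcl : IsClosed {A : L2 ν →L[ℂ] L2 ν | IsCompactOperator ⇑(L * A * R : L2 ν →L[ℂ] L2 ν)} :=
    isClosed_setOfPred_isCompactOperator.preimage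
      (show Continuous fun A : L2 ν →L[ℂ] L2 ν => L * A * R by fun_prop)
  exact hcl.closure_subset_iff.2 h hA

/-- The off-diagonal corners of an operator in the localised Roe algebra are compact if the sets
`P` and `Pᶜ` and the localisation set `Z` meet transversely at infinity. -/
theorem isCompactOperator_cutProj_mul_cutProj_compl (hP : MeasurableSet P)
    (hb : ∀ r : ℝ, Bornology.IsBounded {y | (∃ z ∈ Z, dist y z < r) ∧ (∃ p ∈ P, dist y p < r) ∧
      ∃ q ∈ Pᶜ, dist y q < r})
    {A : L2 ν →L[ℂ] L2 ν} (hA : A ∈ localizedRoeAlgebra ν Z) :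
    IsCompactOperator ⇑(cutProj ν P * A * cutProj ν Pᶜ : L2 ν →L[ℂ] L2 ν) := by
  refine isCompactOperator_of_mem_localizedRoeAlgebra _ _ ?_ hA
  rintro A ⟨hA, ⟨R, hR, hprop⟩, S, hS, hsupp⟩
  -- Continuous cut-offs stand in for the indicator functions, because local compactness and
  -- propagation are tested on continuous functions. The support of `f` lies within `1 + 2 = 3` of
  -- `P`; the radius `R + 3` for `g` thus keeps the supports of `f` and `1 - g` at least `R` apart.
  obtain ⟨k, hk1, hk2⟩ := exists_cutoff Z S
  obtain ⟨f, hf1, -, hf3⟩ := exists_cutoff_one P one_pos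
  obtain ⟨g, hg1, hg2⟩ := exists_cutoff P (R + 3)
  obtain ⟨l, hl1, -, hl3⟩ := exists_cutoff_one Pᶜ one_pos
  have hAk : A * mulOp ν k = A :=
    mul_mulOp_of_mul_compl_eq_zero (IsSupportedNear.bcf hsupp _ hk2)
  have hfA : mulOp ν f * A * mulOp ν (1 - g) = 0 :=
    HasFinitePropagation.bcf hprop _ _ fun x hx y hy => by
      obtain ⟨p, hp, hxp⟩ := hf1 x hx
      have := hg2 y hy p hp
      have := dist_triangle_left y p x
      linarith
  have hPf : cutProj ν P * mulOp ν f = cutProj ν P := by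
    rw [← mulOp_mul_cutProj_comm hP, mulOp_mul_cutProj_of_eq_one hP hf3]
  have hlP : mulOp ν l * cutProj ν Pᶜ = cutProj ν Pᶜ := mulOp_mul_cutProj_of_eq_one hP.compl hl3
  have hAg : cutProj ν P * A * mulOp ν g = cutProj ν P * A := by
    refine mul_mulOp_of_mul_compl_eq_zero ?_
    rw [← hPf, mul_assoc, mul_assoc, ← mul_assoc (mulOp ν f), hfA, mul_zero]
  -- All three cut-offs may be inserted to the right of `A`: `k` by the support condition, `g` by
  -- finite propagation, `l` because it is `1` on `Pᶜ`.
  have e : cutProj ν P * A * cutProj ν Pᶜ =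
      cutProj ν P * (A * mulOp ν (k * g * l)) * cutProj ν Pᶜ := by
    have hc : cutProj ν P * (A * mulOp ν (k * g * l)) * cutProj ν Pᶜ =
        cutProj ν P * (A * mulOp ν k) * mulOp ν g * (mulOp ν l * cutProj ν Pᶜ) := by
      simp only [mulOp_mul, mul_assoc]
    rw [hc, hAk, hAg, hlP]
  rw [e]
  -- The cut-offs `k`, `g`, `l` reach `S + 2`, `R + 5` and `3` from their sets; `S + R + 5` exceeds
  -- none of the needed bounds from below.
  refine ((isCompactOperator_mul_mulOp hA ((hb (S + R + 5)).subset fun y hy => ?_)).clm_comp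
    (cutProj ν P)).comp_clm (cutProj ν Pᶜ)
  have hy1 : y ∈ tsupport ⇑(k * g) := tsupport_mul_subset_left (f := ⇑(k * g)) (g := l) hy
  obtain ⟨z, hz, hz'⟩ := hk1 y (tsupport_mul_subset_left (f := k) (g := g) hy1)
  obtain ⟨p, hp, hp'⟩ := hg1 y (tsupport_mul_subset_right (f := k) (g := g) hy1)
  obtain ⟨q, hq, hq'⟩ := hl1 y (tsupport_mul_subset_right (f := ⇑(k * g)) (g := l) hy)
  exact ⟨⟨z, hz, by linarith⟩, ⟨p, hp, by linarith⟩, q, hq, by linarith⟩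

/-- If `A` is supported near `Z`, it only sees the part of `D` near `Z`. That part is bounded, so a
compactly supported function can be inserted after `A`. -/
theorem isCompactOperator_mul_cutProj (hD : MeasurableSet D)
    (hb : ∀ r : ℝ, Bornology.IsBounded {y | (∃ z ∈ Z, dist y z < r) ∧ y ∈ D})
    {A : L2 ν →L[ℂ] L2 ν} (hA : A ∈ localizedRoeAlgebra ν Z) :
    IsCompactOperator ⇑(A * cutProj ν D : L2 ν →L[ℂ] L2 ν) := by
  rw [← one_mul A]
  refine isCompactOperator_of_mem_localizedRoeAlgebra _ _ ?_ hA
  rintro A ⟨hA, -, S, hS, hsupp⟩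
  obtain ⟨k, hk1, hk2⟩ := exists_cutoff Z S
  obtain ⟨c, hc⟩ := exists_ccBCF_eq_one (hb (S + 2))
  have hAk : A * mulOp ν k = A :=
    mul_mulOp_of_mul_compl_eq_zero (IsSupportedNear.bcf hsupp _ hk2)
  have e : 1 * A * cutProj ν D = A * mulOp ν (ccBCF c) * (mulOp ν k * cutProj ν D) := by
    rw [one_mul, ← mul_assoc, mul_assoc A, ← mulOp_mul, mul_assoc,
      mulOp_mul_cutProj_congr hD (f := ccBCF c * k) (g := k), ← mul_assoc, hAk]
    intro y hy
    by_cases hyk : y ∈ tsupport k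
    · simp [hc y ⟨hk1 y hyk, hy⟩]
    · simp [image_eq_zero_of_notMem_tsupport hyk]
  rw [e]
  exact (hA c).1.comp_clm (mulOp ν k * cutProj ν D)

theorem isCompactOperator_cutProj_mul (hD : MeasurableSet D)
    (hb : ∀ r : ℝ, Bornology.IsBounded {y | (∃ z ∈ Z, dist y z < r) ∧ y ∈ D})
    {A : L2 ν →L[ℂ] L2 ν} (hA : A ∈ localizedRoeAlgebra ν Z) :
    IsCompactOperator ⇑(cutProj ν D * A : L2 ν →L[ℂ] L2 ν) := by
  have := isCompactOperator_star (isCompactOperator_mul_cutProj hD hb (star_mem hA))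
  rwa [star_mul, star_star, star_cutProj] at this

end Truncation

/-! ### Homomorphisms out of `K₁` -/

/-- A stable family of homotopy invariant homomorphisms on the groups `U_n(A⁺)` factors uniquely
through `K₁(A)`. -/
theorem existsUnique_K1_hom {A : Type*} [NonUnitalCStarAlgebra A]
    (f : ∀ n, UnitaryMatrix A n → ℤ) (hmul : ∀ n u v, f n (u * v) = f n u + f n v)
    (hpad : ∀ n m h u, f m (pad A n m h u) = f n u) (hone : ∀ n u, Joined u 1 → f n u = 0) :
    ∃! θ : K1 A →+ ℤ, ∀ (n : ℕ) (u : UnitaryMatrix A n), θ (K1.mk u) = f n u := by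
  let g : UnitaryInf A → Multiplicative ℤ :=
    DirectLimit.lift (pad A) (fun n u => Multiplicative.ofAdd (f n u)) fun n m h u => by
      rw [hpad]
  have hg : ∀ n (u : UnitaryMatrix A n), g (toInf u) = Multiplicative.ofAdd (f n u) :=
    fun n u => rfl
  let G : UnitaryInf A →* Multiplicative ℤ := MonoidHom.mk' g fun x y => by
    obtain ⟨n, u, v, rfl, rfl⟩ := DirectLimit.exists_eq_mk₂ (pad A) x y
    change g (toInf u * toInf v) = g (toInf u) * g (toInf v)
    rw [← toInf_mul, hg, hg, hg, hmul, ofAdd_add]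
  have hG : ∀ x ∈ identityComponent A, G x = 1 := by
    rintro _ ⟨n, u, rfl, hu⟩
    exact (hg n u).trans (by rw [hone n u hu, ofAdd_zero])
  refine ⟨MonoidHom.toAdditiveLeft (QuotientGroup.lift (identityComponent A) G hG),
    fun n u => rfl, fun θ hθ => ?_⟩
  refine AddMonoidHom.ext fun x => ?_
  obtain ⟨y, rfl⟩ := Additive.ofMul.surjective x
  obtain ⟨z, rfl⟩ := QuotientGroup.mk_surjective y
  obtain ⟨n, u, rfl⟩ := DirectLimit.exists_eq_mk (pad A) z
  exact hθ n u

/-! ### Toeplitz operators -/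

section Toeplitz

variable {A : Type*} [NonUnitalCStarAlgebra A] {Y : Type*} [MeasurableSpace Y] {ν : Measure Y}
  {φ : A →⋆ₙₐ[ℂ] (L2 ν →L[ℂ] L2 ν)} {P Q : Set Y} {n : ℕ}

/-- The operator `λ + Π_P^* Π_P a Π_P^* Π_P` on `L²(Y)` associated with `λ + a`. -/
def extendedCompression (φ : A →⋆ₙₐ[ℂ] (L2 ν →L[ℂ] L2 ν)) (P : Set Y)
    (x : Unitization ℂ A) :
    L2 ν →L[ℂ] L2 ν :=
  algebraMap ℂ (L2 ν →L[ℂ] L2 ν) x.fst + cutProj ν P * φ x.snd * cutProj ν P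

/-- The extension of the compression of a matrix over `C*_Y(Z)⁺` to `L²(Y)ⁿ` by its scalar part. -/
def extendedToeplitz (φ : A →⋆ₙₐ[ℂ] (L2 ν →L[ℂ] L2 ν)) (P : Set Y)
    (u : Matrix (Fin n) (Fin n) (Unitization ℂ A)) :
    (Fin n → L2 ν) →L[ℂ] (Fin n → L2 ν) :=
  matrixOp (u.map (extendedCompression φ P))

theorem extendedCompression_zero :
    extendedCompression φ P (0 : Unitization ℂ A) = 0 := by
  simp [extendedCompression]

theorem extendedCompression_one :
    extendedCompression φ P (1 : Unitization ℂ A) = 1 := by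
  simp [extendedCompression]

theorem extendedCompression_add (x y : Unitization ℂ A) :
    extendedCompression φ P (x + y) = extendedCompression φ P x + extendedCompression φ P y := by
  simp only [extendedCompression, Unitization.fst_add, Unitization.snd_add, map_add,
    mul_add, add_mul]
  abel

theorem extendedCompression_sum {ι : Type*} (s : Finset ι)
    (x : ι → Unitization ℂ A) :
    extendedCompression φ P (∑ i ∈ s, x i) = ∑ i ∈ s, extendedCompression φ P (x i) :=
  map_sum (AddMonoidHom.mk' (extendedCompression φ P) extendedCompression_add) x s

theorem continuous_extendedCompression (hφ : Continuous φ) :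
    Continuous (extendedCompression φ P) := by
  refine ((continuous_algebraMap ℂ _).comp Unitization.continuous_fst).add ?_
  exact (continuous_const.mul (hφ.comp Unitization.continuous_snd)).mul
    continuous_const

/-- The off-diagonal corners with respect to `P` of the operators `φ a` are compact. -/
def IsTransverse (φ : A →⋆ₙₐ[ℂ] (L2 ν →L[ℂ] L2 ν)) (P : Set Y) : Prop :=
  ∀ a : A, IsCompactOperator ⇑(cutProj ν P * φ a * cutProj ν Pᶜ : L2 ν →L[ℂ] L2 ν)

/-- The scalar and mixed terms cancel, and the defect is exactly `p a (1 - p) b p`, which contains a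
compact corner. -/
theorem isCompactOperator_extendedCompression_mul (hP : MeasurableSet P)
    (h : IsTransverse φ P) (x y : Unitization ℂ A) :
    IsCompactOperator ⇑(extendedCompression φ P (x * y) -
      extendedCompression φ P x * extendedCompression φ P y : L2 ν →L[ℂ] L2 ν) := by
  have e : extendedCompression φ P (x * y) - extendedCompression φ P x * extendedCompression φ P y =
      cutProj ν P * φ x.snd * cutProj ν Pᶜ *
        (φ y.snd * cutProj ν P) := by
    have hPP := cutProj_mul_self (ν := ν) hP
    simp only [extendedCompression, Unitization.fst_mul, Unitization.snd_mul, map_mul, map_add, map_smul,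
      cutProj_compl hP, Algebra.algebraMap_eq_smul_one]
    generalize cutProj ν P = p at hPP
    generalize φ x.snd = a
    generalize φ y.snd = b
    have hp : p * (p * (b * p)) = p * (b * p) := by rw [← mul_assoc, hPP]
    simp only [mul_add, add_mul, mul_sub, sub_mul, smul_mul_assoc, mul_smul_comm, one_mul,
      mul_one, mul_assoc, hp, smul_add]
    rw [smul_comm y.fst x.fst]
    abel
  rw [e]
  exact (h x.snd).comp_clm (φ y.snd * cutProj ν P)

theorem isCompactOperator_extendedToeplitz_mul (hP : MeasurableSet P) (h : IsTransverse φ P)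
    (u v : Matrix (Fin n) (Fin n) (Unitization ℂ A)) :
    IsCompactOperator ⇑(extendedToeplitz φ P (u * v) - extendedToeplitz φ P u * extendedToeplitz φ P v :
      (Fin n → L2 ν) →L[ℂ] (Fin n → L2 ν)) := by
  rw [extendedToeplitz, extendedToeplitz, extendedToeplitz, ← matrixOp_mul, ← matrixOp_sub]
  refine isCompactOperator_matrixOp fun i j => ?_
  rw [Matrix.sub_apply, Matrix.map_apply, Matrix.mul_apply, Matrix.mul_apply,
    extendedCompression_sum, ← Finset.sum_sub_distrib]
  exact isCompactOperator_sum fun k _ => isCompactOperator_extendedCompression_mul hP h _ _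

theorem extendedToeplitz_one :
    extendedToeplitz φ P
      (1 : Matrix (Fin n) (Fin n) (Unitization ℂ A)) = 1 := by
  rw [extendedToeplitz, Matrix.map_one _ extendedCompression_zero extendedCompression_one,
    matrixOp_one]

theorem isCompactOperator_extendedToeplitz_inv (hP : MeasurableSet P) (h : IsTransverse φ P)
    {u v : Matrix (Fin n) (Fin n) (Unitization ℂ A)} (huv : u * v = 1) :
    IsCompactOperator ⇑(extendedToeplitz φ P u * extendedToeplitz φ P v - 1 :
      (Fin n → L2 ν) →L[ℂ] (Fin n → L2 ν)) := by
  have := (isCompactOperator_extendedToeplitz_mul hP h u v).neg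
  rw [huv, extendedToeplitz_one] at this
  rw [← neg_sub]
  exact this

theorem isFredholm_extendedToeplitz (hP : MeasurableSet P) (h : IsTransverse φ P)
    (u : UnitaryMatrix A n) : (extendedToeplitz φ P u.1).IsFredholm :=
  isFredholm_of_parametrix
    (isCompactOperator_extendedToeplitz_inv hP h (Unitary.star_mul_self_of_mem u.2))
    (isCompactOperator_extendedToeplitz_inv hP h (Unitary.mul_star_self_of_mem u.2))

theorem index_extendedToeplitz_mul (hP : MeasurableSet P) (h : IsTransverse φ P)
    (u v : UnitaryMatrix A n) :
    index (extendedToeplitz φ P (u * v).1) =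
      index (extendedToeplitz φ P u.1) + index (extendedToeplitz φ P v.1) := by
  have hu := isFredholm_extendedToeplitz hP h u
  have hv := isFredholm_extendedToeplitz hP h v
  rw [← index_mul hu hv]
  have hf : (extendedToeplitz φ P u.1 * extendedToeplitz φ P v.1).IsFredholm :=
    isFredholm_mul hu hv
  exact (index_eq_of_isCompactOperator_sub hf (isFredholm_extendedToeplitz hP h (u * v))
    (isCompactOperator_extendedToeplitz_mul hP h u.1 v.1)).symm

theorem index_extendedToeplitz_pad {m : ℕ} (h : n ≤ m)
    (u : UnitaryMatrix A n) :
    index (extendedToeplitz φ P (pad A n m h u).1) =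
      index (extendedToeplitz φ P u.1) := by
  rw [extendedToeplitz, extendedToeplitz, ← index_matrixOp_padMatrix h]
  congr 2
  ext1 i j
  change extendedCompression φ P (padMatrix h u.1 i j) = _
  rw [padMatrix_apply, padMatrix_apply]
  split_ifs
  · rfl
  · exact extendedCompression_one
  · exact extendedCompression_zero

/-- A path of unitaries gives a norm-continuous path of Fredholm operators ending at `1`. -/
theorem index_extendedToeplitz_of_joined (hφ : Continuous φ) (hP : MeasurableSet P) (h : IsTransverse φ P)
    {u : UnitaryMatrix A n} (hu : Joined u 1) :
    index (extendedToeplitz φ P u.1) = 0 := by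
  obtain ⟨γ⟩ := hu
  have hv : Continuous fun t => (γ t).1 := continuous_subtype_val.comp γ.continuous
  have hc : Continuous fun t => extendedToeplitz φ P (γ t).1 :=
    continuous_matrixOp fun i j => (continuous_extendedCompression hφ).comp (hv.matrix_elem i j)
  have := index_eq_of_continuous hc (fun t => isFredholm_extendedToeplitz hP h (γ t)) 0 1
  simp only [γ.source, γ.target] at this
  rw [this, show (1 : UnitaryMatrix A n).1 = 1 from rfl, extendedToeplitz_one]
  exact index_of_isUnit isUnit_one

/-- The scalar parts cancel, so entrywise the difference is `p a p - q a q = (p - q) a p + q a (p -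
q)`. Inserting the indicator of `P Δ Q` next to `a` makes both terms compact. -/
theorem index_extendedToeplitz_congr (hP : MeasurableSet P) (hQ : MeasurableSet Q)
    (hP' : IsTransverse φ P) (hQ' : IsTransverse φ Q)
    (hl : ∀ a, IsCompactOperator ⇑(cutProj ν (symmDiff P Q) * φ a : L2 ν →L[ℂ] L2 ν))
    (hr : ∀ a, IsCompactOperator ⇑(φ a * cutProj ν (symmDiff P Q) : L2 ν →L[ℂ] L2 ν))
    (u : UnitaryMatrix A n) :
    index (extendedToeplitz φ P u.1) = index (extendedToeplitz φ Q u.1) := by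
  refine (index_eq_of_isCompactOperator_sub (isFredholm_extendedToeplitz hQ hQ' u)
    (isFredholm_extendedToeplitz hP hP' u) ?_).symm
  rw [extendedToeplitz, extendedToeplitz, ← matrixOp_sub]
  refine isCompactOperator_matrixOp fun i j => ?_
  set a := (u.1 i j).snd
  have e : (u.1.map (extendedCompression φ P) - u.1.map (extendedCompression φ Q)) i j =
      (cutProj ν P - cutProj ν Q) * (cutProj ν (symmDiff P Q) * φ a) *
        cutProj ν P + cutProj ν Q * (φ a * cutProj ν (symmDiff P Q) *
          (cutProj ν P - cutProj ν Q)) := by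
    rw [← mul_assoc (cutProj ν P - cutProj ν Q), cutProj_sub_mul_symmDiff hP hQ,
      mul_assoc (φ a), symmDiff_mul_cutProj_sub hP hQ]
    simp only [Matrix.sub_apply, Matrix.map_apply, extendedCompression, a]
    noncomm_ring
  rw [e]
  exact (((hl a).clm_comp
    (cutProj ν P - cutProj ν Q)).comp_clm (cutProj ν P)).add
    (((hr a).comp_clm
      (cutProj ν P - cutProj ν Q)).clm_comp (cutProj ν Q))

end Toeplitz

/-! ### Passing between operators on `L²(P)ⁿ` and on `L²(Y)ⁿ` -/

section Compression

variable {A : Type*} [NonUnitalCStarAlgebra A] {Y : Type*} [MeasurableSpace Y] {ν : Measure Y}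
  {φ : A →⋆ₙₐ[ℂ] (L2 ν →L[ℂ] L2 ν)} {P Q : Set Y} {n : ℕ}

/-- The compression of a matrix over `A⁺` to `L²(P)ⁿ`. -/
def compressedToeplitz (φ : A →⋆ₙₐ[ℂ] (L2 ν →L[ℂ] L2 ν)) (P : Set Y)
    (u : Matrix (Fin n) (Fin n) (Unitization ℂ A)) :
    (Fin n → L2 (ν.restrict P)) →L[ℂ] (Fin n → L2 (ν.restrict P)) :=
  matrixOp fun i j =>
    compress P (algebraMap ℂ (L2 ν →L[ℂ] L2 ν) (u i j).fst + φ (u i j).snd)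

theorem compressedToeplitz_apply (u : Matrix (Fin n) (Fin n) (Unitization ℂ A))
    (w : Fin n → L2 (ν.restrict P)) (i : Fin n) :
    compressedToeplitz φ P u w i =
      ∑ j, compress P (algebraMap ℂ (L2 ν →L[ℂ] L2 ν) (u i j).fst + φ (u i j).snd) (w j) :=
  matrixOp_apply _ _ _

theorem extendedToeplitz_apply (u : Matrix (Fin n) (Fin n) (Unitization ℂ A))
    (v : Fin n → L2 ν) (i : Fin n) :
    extendedToeplitz φ P u v i = ∑ j, extendedCompression φ P (u i j) (v j) :=
  matrixOp_apply _ _ _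

/-- The scalar part of a matrix over `A⁺`, acting on `Hⁿ`. -/
def scalarOp (H : Type*) [NormedAddCommGroup H] [NormedSpace ℂ H]
    (u : Matrix (Fin n) (Fin n) (Unitization ℂ A)) : (Fin n → H) →L[ℂ] (Fin n → H) :=
  matrixOp (u.map ((algebraMap ℂ (H →L[ℂ] H)).comp
    (Unitization.fstHom ℂ A : Unitization ℂ A →+* ℂ)))

/-- Taking scalar parts is a ring homomorphism; hence the scalar part of a unitary is invertible. -/
theorem scalarOp_mul_of_mul_eq_one {H : Type*} [NormedAddCommGroup H] [NormedSpace ℂ H]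
    {u v : Matrix (Fin n) (Fin n) (Unitization ℂ A)} (h : u * v = 1) :
    scalarOp H u * scalarOp H v = 1 := by
  rw [scalarOp, scalarOp, ← matrixOp_mul, ← Matrix.map_mul, h,
    Matrix.map_one _ (map_zero _) (map_one _), matrixOp_one]

/-- The restriction map `L²(Y)ⁿ → L²(P)ⁿ`. -/
def restrictPi (ν : Measure Y) (P : Set Y) (n : ℕ) :
    (Fin n → L2 ν) →L[ℂ] (Fin n → L2 (ν.restrict P)) :=
  ContinuousLinearMap.pi fun i => restrictL2 ν P ∘L ContinuousLinearMap.proj i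

/-- The extension by zero `L²(P)ⁿ → L²(Y)ⁿ`. -/
def extendPi (ν : Measure Y) (P : Set Y) (n : ℕ) :
    (Fin n → L2 (ν.restrict P)) →L[ℂ] (Fin n → L2 ν) :=
  ContinuousLinearMap.pi fun i => (restrictL2 ν P).adjoint ∘L ContinuousLinearMap.proj i

theorem restrictPi_apply (v : Fin n → L2 ν) (i : Fin n) :
    restrictPi ν P n v i = restrictL2 ν P (v i) := rfl

theorem extendPi_apply (w : Fin n → L2 (ν.restrict P)) (i : Fin n) :
    extendPi ν P n w i = (restrictL2 ν P).adjoint (w i) := rfl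

theorem restrictPi_extendPi (hP : MeasurableSet P) (w : Fin n → L2 (ν.restrict P)) :
    restrictPi ν P n (extendPi ν P n w) = w :=
  funext fun i => restrictL2_adjoint_apply hP (w i)

theorem extendedToeplitz_extendPi (hP : MeasurableSet P)
    (u : Matrix (Fin n) (Fin n) (Unitization ℂ A)) (w : Fin n → L2 (ν.restrict P)) :
    extendedToeplitz φ P u (extendPi ν P n w) = extendPi ν P n (compressedToeplitz φ P u w) := by
  funext i
  rw [extendPi_apply, extendedToeplitz_apply, compressedToeplitz_apply, map_sum]
  refine Finset.sum_congr rfl fun j _ => ?_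
  simp [extendedCompression, compress, cutProj, extendPi_apply, restrictL2_adjoint_apply hP,
    Algebra.algebraMap_eq_smul_one]

theorem restrictPi_extendedToeplitz (hP : MeasurableSet P)
    (u : Matrix (Fin n) (Fin n) (Unitization ℂ A)) (v : Fin n → L2 ν) :
    restrictPi ν P n (extendedToeplitz φ P u v) =
      compressedToeplitz φ P u (restrictPi ν P n v) := by
  funext i
  rw [restrictPi_apply, extendedToeplitz_apply, compressedToeplitz_apply, map_sum]
  refine Finset.sum_congr rfl fun j _ => ?_
  simp [extendedCompression, compress, cutProj, restrictPi_apply, restrictL2_adjoint_apply hP,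
    Algebra.algebraMap_eq_smul_one]

theorem extendedToeplitz_of_restrictPi_eq_zero
    (u : Matrix (Fin n) (Fin n) (Unitization ℂ A)) {v : Fin n → L2 ν}
    (hv : restrictPi ν P n v = 0) : extendedToeplitz φ P u v = scalarOp (L2 ν) u v := by
  funext i
  rw [extendedToeplitz_apply, scalarOp, matrixOp_apply]
  refine Finset.sum_congr rfl fun j _ => ?_
  have : restrictL2 ν P (v j) = 0 := congrFun hv j
  simp [extendedCompression, cutProj, this]

theorem restrictPi_scalarOp (u : Matrix (Fin n) (Fin n) (Unitization ℂ A)) {v : Fin n → L2 ν}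
    (hv : restrictPi ν P n v = 0) : restrictPi ν P n (scalarOp (L2 ν) u v) = 0 := by
  funext i
  rw [restrictPi_apply, scalarOp, matrixOp_apply, map_sum]
  refine Finset.sum_eq_zero fun j _ => ?_
  have : restrictL2 ν P (v j) = 0 := congrFun hv j
  simp [Algebra.algebraMap_eq_smul_one, this]

/-- The extended operator is block diagonal: the compression on vectors supported in `P`, the scalar
part of `u` on those vanishing on `P`. The second block is inverted by the scalar part of `star u`.
-/
theorem index_compressedToeplitz (hP : MeasurableSet P) (u : UnitaryMatrix A n) :
    index (compressedToeplitz φ P u.1) = index (extendedToeplitz φ P u.1) := by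
  have h1 := scalarOp_mul_of_mul_eq_one (H := L2 ν) (Unitary.mul_star_self_of_mem u.2)
  have h2 := scalarOp_mul_of_mul_eq_one (H := L2 ν) (Unitary.star_mul_self_of_mem u.2)
  refine (index_eq_of_splitting (restrictPi ν P n).toLinearMap (extendPi ν P n).toLinearMap
    (scalarOp (L2 ν) (star u.1)) (restrictPi_extendPi hP) (extendedToeplitz_extendPi hP u.1)
    (restrictPi_extendedToeplitz hP u.1) (fun v hv => ?_) fun v hv => ?_).symm
  · rw [extendedToeplitz_of_restrictPi_eq_zero _ (restrictPi_scalarOp _ hv)]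
    exact DFunLike.congr_fun h1 v
  · rw [extendedToeplitz_of_restrictPi_eq_zero _ hv]
    exact DFunLike.congr_fun h2 v

theorem isCompactOperator_compressedToeplitz_inv (hP : MeasurableSet P) (h : IsTransverse φ P)
    {u v : Matrix (Fin n) (Fin n) (Unitization ℂ A)} (huv : u * v = 1) :
    IsCompactOperator ⇑(compressedToeplitz φ P u * compressedToeplitz φ P v - 1 :
      (Fin n → L2 (ν.restrict P)) →L[ℂ] (Fin n → L2 (ν.restrict P))) := by
  have e : compressedToeplitz φ P u * compressedToeplitz φ P v - 1 =
      restrictPi ν P n ∘L (extendedToeplitz φ P u * extendedToeplitz φ P v - 1) ∘L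
        extendPi ν P n := by
    ext1 w
    simp only [sub_apply, mul_apply_eq_comp, one_apply_eq_self, ContinuousLinearMap.comp_apply,
      map_sub, extendedToeplitz_extendPi hP, restrictPi_extendPi hP]
  rw [e]
  exact ((isCompactOperator_extendedToeplitz_inv hP h huv).comp_clm (extendPi ν P n)).clm_comp
    (restrictPi ν P n)

theorem isFredholm_compressedToeplitz (hP : MeasurableSet P) (h : IsTransverse φ P)
    (u : UnitaryMatrix A n) : (compressedToeplitz φ P u.1).IsFredholm :=
  isFredholm_of_parametrix
    (isCompactOperator_compressedToeplitz_inv hP h (Unitary.star_mul_self_of_mem u.2))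
    (isCompactOperator_compressedToeplitz_inv hP h (Unitary.mul_star_self_of_mem u.2))

/-- The homomorphism `θ` computes the index of compressions to `L²(P)`. -/
def IsIndexHom (φ : A →⋆ₙₐ[ℂ] (L2 ν →L[ℂ] L2 ν)) (P : Set Y) (θ : K1 A →+ ℤ) : Prop :=
  ∀ (n : ℕ) (u : UnitaryMatrix A n),
    (compressedToeplitz φ P u.1).IsFredholm ∧ θ (K1.mk u) = index (compressedToeplitz φ P u.1)

theorem isIndexHom_iff (hP : MeasurableSet P) (h : IsTransverse φ P) (θ : K1 A →+ ℤ) :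
    IsIndexHom φ P θ ↔ ∀ (n : ℕ) (u : UnitaryMatrix A n),
      θ (K1.mk u) = index (extendedToeplitz φ P u.1) := by
  refine forall₂_congr fun n u => ?_
  rw [index_compressedToeplitz hP]
  exact and_iff_right (isFredholm_compressedToeplitz hP h u)

theorem existsUnique_isIndexHom (hφ : Continuous φ) (hP : MeasurableSet P) (h : IsTransverse φ P) :
    ∃! θ, IsIndexHom φ P θ := by
  simp only [isIndexHom_iff hP h]
  exact existsUnique_K1_hom (fun _ u => index (extendedToeplitz φ P u.1))
    (fun _ => index_extendedToeplitz_mul hP h) (fun _ _ => index_extendedToeplitz_pad)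
    (fun _ _ => index_extendedToeplitz_of_joined hφ hP h)

theorem existsUnique_isIndexHom_eq (hφ : Continuous φ) (hP : MeasurableSet P)
    (hQ : MeasurableSet Q) (hP' : IsTransverse φ P) (hQ' : IsTransverse φ Q)
    (hl : ∀ a, IsCompactOperator ⇑(cutProj ν (symmDiff P Q) * φ a : L2 ν →L[ℂ] L2 ν))
    (hr : ∀ a, IsCompactOperator ⇑(φ a * cutProj ν (symmDiff P Q) : L2 ν →L[ℂ] L2 ν)) :
    (∃! θ, IsIndexHom φ P θ) ∧ (∃! θ', IsIndexHom φ Q θ') ∧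
      ∀ θ θ', IsIndexHom φ P θ → IsIndexHom φ Q θ' → θ = θ' := by
  have h := existsUnique_isIndexHom hφ hP hP'
  -- Since the indices agree, `θ'` is also an index homomorphism for `P`, and uniqueness for `P`
  -- applies.
  refine ⟨h, existsUnique_isIndexHom hφ hQ hQ', fun θ θ' hθ hθ' => h.unique hθ ?_⟩
  rw [isIndexHom_iff hQ hQ'] at hθ'
  simpa only [isIndexHom_iff hP hP', index_extendedToeplitz_congr hP hQ hP' hQ' hl hr] using hθ'

end Compression

/-! ### Admissible subsets of half-spaces -/

section HalfSpace

variable {X : Type*} [MetricSpace X] [ProperSpace X] [MeasurableSpace X] [BorelSpace X]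
  {μ : Measure X} [IsFiniteMeasureOnCompacts μ] {W : TopologicalSpace.Closeds X} {P : Set W}

theorem IsAdmissible.measurableSet {X : Type*} [MetricSpace X] [MeasurableSpace X] [BorelSpace X]
    {μ : Measure X} {W : TopologicalSpace.Closeds X} {P : Set W} (hP : IsAdmissible μ W P) : MeasurableSet P := by
  rw [← hP.regularClosed]
  exact isClosed_closure.measurableSet

/-- The frontier of `W` lies in the closure of the complement, and closed thickenings do not
distinguish a set from its closure. -/
theorem mem_cthickening_compl {X : Type*} [MetricSpace X] {W : TopologicalSpace.Closeds X}
    {r R : ℝ} (hr : r ≤ R) {y : W}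
    (hy : ∃ z ∈ (Subtype.val ⁻¹' frontier (W : Set X) : Set W), dist y z < r) :
    (y : X) ∈ cthickening R (W : Set X)ᶜ := by
  obtain ⟨z, hz, hyz⟩ := hy
  rw [← cthickening_closure]
  have hz' : (z : X) ∈ closure (W : Set X)ᶜ := by
    rw [mem_preimage, frontier_eq_closure_inter_closure] at hz
    exact hz.2
  exact mem_cthickening_of_dist_le _ _ _ _ hz' (hyz.le.trans hr)

theorem mem_cthickening_image {X : Type*} [MetricSpace X] {W : TopologicalSpace.Closeds X}
    {r R : ℝ} (hr : r ≤ R) {y : W} {S : Set W}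
    (hy : ∃ z ∈ S, dist y z < r) : (y : X) ∈ cthickening R (Subtype.val '' S : Set X) := by
  obtain ⟨z, hz, hyz⟩ := hy
  exact mem_cthickening_of_dist_le _ _ _ _ (mem_image_of_mem _ hz) (hyz.le.trans hr)

/-- The inclusion of the Roe algebra of `W` localised at `∂W` in the bounded operators. -/
abbrev boundaryInclusion (μ : Measure X) [IsFiniteMeasureOnCompacts μ]
    (W : TopologicalSpace.Closeds X) :
    boundaryRoeAlgebra μ W →⋆ₙₐ[ℂ] (L2 (subMeasure μ W) →L[ℂ] L2 (subMeasure μ W)) :=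
  NonUnitalStarSubalgebraClass.subtype (boundaryRoeAlgebra μ W)

theorem IsAdmissible.isTransverse (hP : IsAdmissible μ W P) :
    IsTransverse (boundaryInclusion μ W) P := by
  intro a
  refine isCompactOperator_cutProj_mul_cutProj_compl hP.measurableSet (fun r => ?_) a.2
  -- Admissibility speaks of nonnegative radii only, hence `max r 0`; below, `max S (max r 0)`
  -- serves both thickenings in transversality.
  obtain ⟨S, -, hS'⟩ := hP.coarselyExcisive (max r 0) (le_max_right _ _)
  rw [← Bornology.isBounded_image_subtype_val]
  refine (hP.transverse (max S (max r 0)) (by positivity)).subset ?_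
  rintro _ ⟨y, ⟨hz, hp, hq⟩, rfl⟩
  refine ⟨mem_cthickening_compl ((le_max_left r 0).trans (le_max_right _ _)) hz,
    cthickening_mono (le_max_left _ _) _ (hS' ⟨mem_cthickening_image (le_max_left _ _) hp, ?_⟩)⟩
  obtain ⟨q, hq, hyq⟩ := hq
  exact mem_cthickening_image (le_max_left _ _) ⟨q, subset_closure hq, hyq⟩

theorem AreBordant.isBounded {X : Type*} [MetricSpace X] [MeasurableSpace X] {μ : Measure X}
    {W : TopologicalSpace.Closeds X} {P Q : Set W} (h : AreBordant μ W P Q) (r : ℝ) :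
    Bornology.IsBounded {y : W |
      (∃ z ∈ (Subtype.val ⁻¹' frontier (W : Set X) : Set W), dist y z < r) ∧ y ∈ symmDiff P Q} := by
  rw [← Bornology.isBounded_image_subtype_val]
  refine (h.bounded (max r 0) (le_max_right _ _)).subset ?_
  rintro _ ⟨y, ⟨hz, hy⟩, rfl⟩
  exact ⟨mem_cthickening_compl (le_max_left _ _) hz, mem_image_of_mem _ hy⟩


end HalfSpace

end CoarseIndex

end

theorem proposition4p6 {X : Type*} [MetricSpace X] [ProperSpace X] [MeasurableSpace X]
    [BorelSpace X] (μ : Measure X) [IsFiniteMeasureOnCompacts μ]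
    (W : TopologicalSpace.Closeds X) (hW : CoarseIndex.IsHalfSpace μ W) (P Q : Set W)
    (hP : CoarseIndex.IsAdmissible μ W P) (hQ : CoarseIndex.IsAdmissible μ W Q)
    (hPQ : CoarseIndex.AreBordant μ W P Q) :
    (∃! θ, CoarseIndex.IsIndexMap μ W P θ) ∧ (∃! θ', CoarseIndex.IsIndexMap μ W Q θ') ∧
      ∀ θ θ', CoarseIndex.IsIndexMap μ W P θ → CoarseIndex.IsIndexMap μ W Q θ' → θ = θ' :=
  have hD := hP.measurableSet.symmDiff hQ.measurableSet
  -- For the inclusion of the Roe algebra, `IsIndexHom` agrees by definition with `IsIndexMap`,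
  -- since `a + λ` acts as `λ · 1 + a`.
  CoarseIndex.existsUnique_isIndexHom_eq (φ := CoarseIndex.boundaryInclusion μ W)
    continuous_subtype_val hP.measurableSet hQ.measurableSet hP.isTransverse hQ.isTransverse
    (fun a => CoarseIndex.isCompactOperator_cutProj_mul hD hPQ.isBounded a.2)
    (fun a => CoarseIndex.isCompactOperator_mul_cutProj hD hPQ.isBounded a.2)
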